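/- **Setting.** Let $B>0$ and $p\in(0,1]$. $M_n$ is an $n\times n$ symmetric random matrix with entries $m_{ij}=m_{ji}=\delta_{ij}\xi_{ij}$, $i\le j$, where all the variables $\delta_{ij},\xi_{ij}$ $(i\le j)$ are independent, $\delta_{ij}$ is Bernoulli with $\mathbb P(\delta_{ij}=1)=p$, and the $\xi_{ij}$ are identically distributed with mean $0$, variance $1$ and subgaussian moment at most $B$, i.e. $\mathbb P(|\xi_{ij}|>t)\le 2e^{-t^2/B^2}$ for all $t>0$. **Parameters.** For $K,C>0$ put $$M=\frac{n}{(np)^{1/8}},\quad \alpha=(np)^{-1/16},\quad \ell_0=\Big\lceil\frac{\log(1/(8p))}{\log\sqrt{pn}}\Big\rceil,\quad \rho=(CK)^{-\ell_0-6},\quad \rho'=\frac{\rho^2}{4}\sqrt{\frac{M\alpha}{n}},\quad \varepsilon_0'=\big(\rho'\sqrt{pM}\big)^{-1/2}.$$ **Incompressible vectors.** $\mathrm{Incomp}(M,\rho)$ is the set of unit vectors $x\in\mathbb R^n$ such that $\|x-y\|_2>\rho$ for every $y\in\mathbb R^n$ with at most $M$ nonzero coordinates. **LCD.** Let $\delta_0\in(0,1)$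 and $\log_+ t=\max(\log t,0)$. For a finite index set $I$ and $x\in\mathbb R^I$, $$D(x)=\inf\Big\{\theta>0:\ \mathrm{dist}(\theta x,\mathbb Z^I)<(\delta_0p)^{-1/2}\sqrt{\log_+(\sqrt{\delta_0p}\,\theta)}\Big\}.$$ **Regularized LCD.** For each $v\in\mathrm{Incomp}(M,\rho)$ choose a set $\sigma=\sigma(v)\subset\{k:\rho/\sqrt{2n}\le|v_k|\le 1/\sqrt M\}$ of size exactly $\lceil M\rho^2/2\rceil$ and a set $\tau'=\tau'(v)$ of $\lfloor M\rfloor$ indices of coordinates of $v$ of largest magnitude. Put $\tau=\tau'\setminus\sigma$, $\bar\sigma=[n]\setminus(\tau\cup\sigma)$ and $k_0=\lfloor (n-|\tau|)/\lceil\alpha n\rceil\rfloor$. Enumerate $\sigma$ and $\bar\sigma$ in increasing order, and for $1\le k\le k_0$ let $I_k$ consist of the elements of $\sigma$ in positions $(k-1)a+1,\dots,ka$ and the elements of $\bar\sigma$ in positions $(k-1)b+1,\dots,kb$, where $a=\lceil M\rho^2/(2k_0)\rceil$ and $b=\lceil|\bar\sigma|/k_0\rceil$ (positions past the end of an enumeration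 are ignored). Let $v_I\in\mathbb R^I$ be the restriction of $v$ to $I$, and $$\hat D(v)=\max_{1\le k\le k_0}D\big(v_{I_k}/\|v_{I_k}\|_2\big),\qquad \hat S_D=\{v\in\mathrm{Incomp}(M,\rho):\ D\le\hat D(v)\le 2D\}.$$ **Proposition (small LCD).** Let $\delta,B,K,C,\bar c>0$ and $\delta_0\in(0,1)$. There exist $c'',\tilde c>0$ and $n_0\in\mathbb N$, depending only on these six numbers, such that the following holds for all $n\ge n_0$, all $p$ with $n^{-1+\delta}\le p\le1$, every random matrix $M_n$ as above, and every choice of the sets $\sigma(v),\tau'(v)$. For every $\lambda\in[-K\sqrt{pn},K\sqrt{pn}]$ and every $D$ with $\rho'\sqrt M\le D\le\frac1{\bar c}\sqrt{\alpha n}$, $$\mathbb P\Big(\exists\,v\in\hat S_D:\ \|(M_n-\lambda)v\|_2\le\tilde c\,\varepsilon_0'\,(pn)^{7/16}\Big)\le\exp(-c''n).$$ (The probability is understood as outer probability if the event is not measurable.) -/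

import Mathlib

open MeasureTheory ProbabilityTheory
open scoped ENNReal Matrix

noncomputable section

namespace SparseSym

/-! ### The random matrix -/

/-- `X` has subgaussian moment at most `B`. -/
def SubgaussianMomentLE {Ω : Type*} [MeasurableSpace Ω] (X : Ω → ℝ) (B : ℝ) (μ : Measure Ω) :
    Prop :=
  ∀ t : ℝ, 0 < t → μ {ω | t < |X ω|} ≤ ENNReal.ofReal (2 * Real.exp (-(t ^ 2 / B ^ 2)))

/-- The entries of a sparse symmetric random matrix. The entry at position `(i, j)` is
indexed by the unordered pair `s(i, j)`, that is, by the positions `i ≤ j` on and above the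
diagonal. The `η e` are Bernoulli(`p`) variables, the `ξ e` are identically distributed with mean
zero, variance one and subgaussian moment at most `B`, and all these variables are jointly
independent. -/
structure IsSparseEntries {Ω : Type*} [MeasurableSpace Ω] (μ : Measure Ω) (n : ℕ) (p B : ℝ)
    (η ξ : Sym2 (Fin n) → Ω → ℝ) : Prop where
  measurable_η : ∀ e, Measurable (η e)
  measurable_ξ : ∀ e, Measurable (ξ e)
  indep : iIndepFun (Sum.elim η ξ) μ
  zero_or_one : ∀ e, ∀ᵐ ω ∂μ, η e ω = 0 ∨ η e ω = 1
  prob_one : ∀ e, μ {ω | η e ω = 1} = ENNReal.ofReal p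
  identDistrib : ∀ e e', IdentDistrib (ξ e) (ξ e') μ μ
  mean_zero : ∀ e, ∫ ω, ξ e ω ∂μ = 0
  variance_one : ∀ e, variance (ξ e) μ = 1
  subgaussian : ∀ e, SubgaussianMomentLE (ξ e) B μ

/-- The symmetric random matrix with entries `m i j = η i j * ξ i j`. -/
def sparseMatrix {Ω : Type*} {n : ℕ} (η ξ : Sym2 (Fin n) → Ω → ℝ) (ω : Ω) :
    Matrix (Fin n) (Fin n) ℝ :=
  Matrix.of fun i j => η s(i, j) ω * ξ s(i, j) ω

/-! ### Compressible and incompressible vectors -/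

/-- Vectors with at most `M` nonzero coordinates. -/
def Sparse (n : ℕ) (M : ℝ) : Set (EuclideanSpace ℝ (Fin n)) :=
  {x | ((Finset.univ.filter fun i => x i ≠ 0).card : ℝ) ≤ M}

/-- Unit vectors within Euclidean distance `ρ` of a sparse vector. -/
def Comp (n : ℕ) (M ρ : ℝ) : Set (EuclideanSpace ℝ (Fin n)) :=
  {x | ‖x‖ = 1 ∧ ∃ y ∈ Sparse n M, ‖x - y‖ ≤ ρ}

/-- Unit vectors that are not compressible. -/
def Incomp (n : ℕ) (M ρ : ℝ) : Set (EuclideanSpace ℝ (Fin n)) :=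
  {x | ‖x‖ = 1 ∧ x ∉ Comp n M ρ}

/-! ### The least common denominator -/

/-- The integer points of `ℝ^ι`. -/
def intPoints (ι : Type*) : Set (EuclideanSpace ℝ ι) :=
  {z | ∀ i, ∃ m : ℤ, z i = m}

/-- The least common denominator of `x`, with parameters `δ₀` and `p`. -/
def LCD {ι : Type*} [Fintype ι] (δ₀ p : ℝ) (x : EuclideanSpace ℝ ι) : ℝ :=
  sInf {θ : ℝ | 0 < θ ∧ Metric.infDist (θ • x) (intPoints ι) <
    (δ₀ * p) ^ (-(1 / 2) : ℝ) * Real.sqrt (Real.posLog (Real.sqrt (δ₀ * p) * θ))}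

/-! ### The partition of the coordinates -/

/-- The coordinates of `v` of magnitude between `ρ / √(2n)` and `1 / √M`. -/
def spreadSet {n : ℕ} (M ρ : ℝ) (v : EuclideanSpace ℝ (Fin n)) : Finset (Fin n) :=
  Finset.univ.filter fun k => ρ / Real.sqrt (2 * n) ≤ |v k| ∧ |v k| ≤ 1 / Real.sqrt M

/-- `σ` and `τ'` are admissible choices of index sets for the incompressible vectors: `σ v`
consists of exactly `⌈Mρ²/2⌉` indices of the spread set of `v`, and `τ' v` is a set of `⌊M⌋`
indices of coordinates of `v` with the largest magnitudes (ties are broken arbitrarily). -/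
structure IsChoice {n : ℕ} (M ρ : ℝ) (σ τ' : EuclideanSpace ℝ (Fin n) → Finset (Fin n)) :
    Prop where
  subset_spread : ∀ v ∈ Incomp n M ρ, σ v ⊆ spreadSet M ρ v
  card_sigma : ∀ v ∈ Incomp n M ρ, (σ v).card = ⌈M * ρ ^ 2 / 2⌉₊
  card_tau : ∀ v ∈ Incomp n M ρ, (τ' v).card = ⌊M⌋₊
  largest : ∀ v ∈ Incomp n M ρ, ∀ i ∈ τ' v, ∀ j ∉ τ' v, |v j| ≤ |v i|

/-- The elements of `S` whose position in the increasing enumeration of `S`, counted from `0`,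
lies in `[a, b)`. -/
def slice {n : ℕ} (S : Finset (Fin n)) (a b : ℕ) : Finset (Fin n) :=
  S.filter fun i => a ≤ (S.filter fun j => j < i).card ∧ (S.filter fun j => j < i).card < b

/-- The number `k₀` of blocks, `⌊(n - |τ|) / ⌈αn⌉⌋` with `τ = τ' \ σ`. -/
def numBlocks {n : ℕ} (α : ℝ) (σ τ' : Finset (Fin n)) : ℕ :=
  (n - (τ' \ σ).card) / ⌈α * n⌉₊

/-- The complement `σbar` of `τ ∪ σ`, with `τ = τ' \ σ`. -/
def sigmaBar {n : ℕ} (σ τ' : Finset (Fin n)) : Finset (Fin n) :=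
  Finset.univ \ ((τ' \ σ) ∪ σ)

/-- The block with number `k`, counted from `0`: the next `⌈Mρ²/(2k₀)⌉` elements of `σ` together
with the next `⌈|σbar|/k₀⌉` elements of `σbar`. -/
def block {n : ℕ} (M ρ α : ℝ) (σ τ' : Finset (Fin n)) (k : ℕ) : Finset (Fin n) :=
  let k₀ := numBlocks α σ τ'
  let a := ⌈M * ρ ^ 2 / (2 * k₀)⌉₊
  let b := ⌈((sigmaBar σ τ').card : ℝ) / k₀⌉₊
  slice σ (k * a) ((k + 1) * a) ∪ slice (sigmaBar σ τ') (k * b) ((k + 1) * b)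

/-- The restriction of `v` to the coordinates in `I`. -/
def restrict {n : ℕ} (v : EuclideanSpace ℝ (Fin n)) (I : Finset (Fin n)) : EuclideanSpace ℝ I :=
  WithLp.toLp 2 fun i => v i

/-- The regularized LCD of `v`: the maximum over the blocks of the LCD of the normalized
restriction of `v` to the block. -/
def regLCD {n : ℕ} (δ₀ p M ρ α : ℝ) (σ τ' : Finset (Fin n)) (v : EuclideanSpace ℝ (Fin n)) : ℝ :=
  ⨆ k : Fin (numBlocks α σ τ'),
    LCD δ₀ p (‖restrict v (block M ρ α σ τ' k)‖⁻¹ • restrict v (block M ρ α σ τ' k))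

/-- Incompressible vectors with regularized LCD between `D` and `2D`. -/
def levelSet {n : ℕ} (δ₀ p M ρ α : ℝ) (σ τ' : EuclideanSpace ℝ (Fin n) → Finset (Fin n)) (D : ℝ) :
    Set (EuclideanSpace ℝ (Fin n)) :=
  {v | v ∈ Incomp n M ρ ∧ D ≤ regLCD δ₀ p M ρ α (σ v) (τ' v) v ∧
    regLCD δ₀ p M ρ α (σ v) (τ' v) v ≤ 2 * D}

/-! ### The parameters -/

/-- `M = n / (np)^{1/8}`. -/
def parM (n : ℕ) (p : ℝ) : ℝ := n / (n * p) ^ (1 / 8 : ℝ)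

/-- `α = (np)^{-1/16}`. -/
def parα (n : ℕ) (p : ℝ) : ℝ := (n * p) ^ (-(1 / 16) : ℝ)

/-- `ℓ₀ = ⌈log (1 / (8p)) / log √(pn)⌉`. -/
def ell₀ (n : ℕ) (p : ℝ) : ℤ := ⌈Real.log (1 / (8 * p)) / Real.log (Real.sqrt (p * n))⌉

/-- `ρ = (CK)^{-ℓ₀ - 6}`. -/
def parρ (C K : ℝ) (n : ℕ) (p : ℝ) : ℝ := (C * K) ^ (-ell₀ n p - 6)

/-- `ρ' = (ρ² / 4) √(Mα / n)`. -/
def parρ' (C K : ℝ) (n : ℕ) (p : ℝ) : ℝ :=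
  parρ C K n p ^ 2 / 4 * Real.sqrt (parM n p * parα n p / n)

/-- `ε₀' = (ρ' √(pM))^{-1/2}`. -/
def parε₀' (C K : ℝ) (n : ℕ) (p : ℝ) : ℝ :=
  (parρ' C K n p * Real.sqrt (p * parM n p)) ^ (-(1 / 2) : ℝ)

end SparseSym

end

/-! The proof is a union bound over a net whose size is exponential in `n`. Write `u = (np)^{1/32}`;
then `M = n/u⁴`, `α = u⁻²`, and the threshold `t = ε₀'(pn)^{7/16}` satisfies `t² = 4u¹⁷/ρ²`. Since
`np ≥ n^δ`, `u` exceeds any constant for large `n` and beats `log n`, while `ρ` stays above a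
positive constant.

The net. A bound on the LCD of each block makes `v` there close to a multiple `s z` of an integer
point (`exists_int_approx_of_LCD_lt`). The upper bound on `D` bounds the total of `|z|²` over the at
most `1/α` blocks by a multiple of `n`, so there are only `exp(O(n))` candidates for `z`. The
remaining error has squared norm at most `h²n` off `τ`, so rounding it to `hℤⁿ` costs another
`exp(O(n))`. The at most `M` coordinates in `τ` and the scales `s` are counted trivially, because `M
log n` and `α⁻¹ log n` are `O(n)`. See `exists_mem_net` and `card_net_le_exp`.

The approximation. The rounding is chosen after the matrix is known, so that the image of the
rounding error is at most `h` times the Hilbert-Schmidt norm (`exists_rounding`); only the net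
itself must be deterministic. No operator norm is needed: the Hilbert-Schmidt norm is of order
`√(pn²)` outside an event of probability `exp(-pn²) ≤ exp(-n)` (`measure_sum_sq_ge_le`), and `h` is
tuned to make the error at most `t`.

Small balls. A net point near `v` is still spread on `σ(v)`. The submatrix with rows off `σ` and
columns in `σ` has independent entries, so a characteristic function estimate gives `exp(n/2)
q^{n-|σ|}` for each point (`measure_norm_le_le`). The base `q` can be made as small as desired by
taking `u` large, hence it beats the size of the net. -/

noncomputable section

namespace SparseSym

/-! ### Rounding to a lattice -/

/-- A derandomized rounding. Each coordinate has two neighbours in `hℤ`, with errors of opposite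
signs, so one of them makes the cross term with the image accumulated so far nonpositive. Each
column then adds at most `h²` times its squared norm. -/
lemma exists_rounding_finset {n : ℕ} (A : Matrix (Fin n) (Fin n) ℝ) (w : Fin n → ℝ) {h : ℝ}
    (hh : 0 < h) (s : Finset (Fin n)) :
    ∃ m : Fin n → ℤ, (∀ i, |w i - h * m i| ≤ h) ∧
      ∑ i, (∑ j ∈ s, A i j * (w j - h * m j)) ^ 2 ≤ h ^ 2 * ∑ j ∈ s, ∑ i, A i j ^ 2 := by
  induction s using Finset.induction_on with
  | empty =>
    refine ⟨fun i => ⌊w i / h⌋, fun i => ?_, by simp⟩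
    have e : w i - h * ⌊w i / h⌋ = h * Int.fract (w i / h) := by
      rw [Int.fract]; field_simp
    rw [e, abs_of_nonneg (mul_nonneg hh.le (Int.fract_nonneg _))]
    nlinarith [Int.fract_lt_one (w i / h)]
  | insert a s ha ih =>
    obtain ⟨m, hm, hs⟩ := ih
    set b : Fin n → ℝ := fun i => ∑ j ∈ s, A i j * (w j - h * m j) with hb
    obtain ⟨k, hk, hk'⟩ : ∃ k : ℤ, |w a - h * k| ≤ h ∧
        (w a - h * k) * ∑ i, b i * A i a ≤ 0 := by
      have e : w a - h * ⌊w a / h⌋ = h * Int.fract (w a / h) := by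
        rw [Int.fract]; field_simp
      have h0 := Int.fract_nonneg (w a / h)
      have h1 := Int.fract_lt_one (w a / h)
      rcases le_total (∑ i, b i * A i a) 0 with hB | hB
      · refine ⟨⌊w a / h⌋, ?_, ?_⟩
        · rw [e, abs_of_nonneg (mul_nonneg hh.le h0)]; nlinarith
        · rw [e]; exact mul_nonpos_of_nonneg_of_nonpos (mul_nonneg hh.le h0) hB
      · have e' : w a - h * ((⌊w a / h⌋ + 1 : ℤ) : ℝ) = -(h * (1 - Int.fract (w a / h))) := by
          push_cast; linarith
        refine ⟨⌊w a / h⌋ + 1, ?_, ?_⟩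
        · rw [e', abs_neg, abs_of_nonneg (mul_nonneg hh.le (by linarith))]; nlinarith
        · rw [e']
          exact mul_nonpos_of_nonpos_of_nonneg
            (neg_nonpos.2 (mul_nonneg hh.le (by linarith))) hB
    refine ⟨Function.update m a k, fun i => ?_, ?_⟩
    · by_cases hi : i = a
      · subst hi; simpa using hk
      · simpa [hi] using hm i
    · have e : ∀ i, ∑ j ∈ insert a s, A i j * (w j - h * (Function.update m a k j : ℤ))
          = A i a * (w a - h * k) + b i := by
        intro i
        rw [Finset.sum_insert ha, Function.update_self, hb]
        congr 1
        refine Finset.sum_congr rfl fun j hj => ?_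
        rw [Function.update_of_ne (by rintro rfl; exact ha hj)]
      simp_rw [e]
      rw [Finset.sum_insert ha]
      have e2 : ∑ i, (A i a * (w a - h * k) + b i) ^ 2 = (w a - h * k) ^ 2 * ∑ i, A i a ^ 2
          + 2 * ((w a - h * k) * ∑ i, b i * A i a) + ∑ i, b i ^ 2 := by
        simp only [Finset.mul_sum, ← Finset.sum_add_distrib]
        exact Finset.sum_congr rfl fun i _ => by ring
      have h3 : (w a - h * k) ^ 2 ≤ h ^ 2 := by
        rw [← sq_abs]; exact pow_le_pow_left₀ (abs_nonneg _) hk 2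
      have h4 : 0 ≤ ∑ i, A i a ^ 2 := Finset.sum_nonneg fun i _ => sq_nonneg _
      rw [e2]
      nlinarith [mul_le_mul_of_nonneg_right h3 h4]

/-- Sequential rounding: the image of the rounding error is controlled by the Hilbert-Schmidt
norm. -/
lemma exists_rounding {n : ℕ} (A : Matrix (Fin n) (Fin n) ℝ) (w : Fin n → ℝ) {h : ℝ}
    (hh : 0 < h) :
    ∃ m : Fin n → ℤ, (∀ i, |w i - h * m i| ≤ h) ∧
      ∑ i, (A *ᵥ fun j => w j - h * m j) i ^ 2 ≤ h ^ 2 * ∑ i, ∑ j, A i j ^ 2 := by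
  obtain ⟨m, hm, hs⟩ := exists_rounding_finset A w hh Finset.univ
  exact ⟨m, hm, by rw [Finset.sum_comm]; exact hs⟩

/-! ### Counting integer points -/

lemma exists_sum_exp_neg_sq_le :
    ∃ W : ℝ, 1 ≤ W ∧ ∀ s : Finset ℤ, ∑ m ∈ s, Real.exp (-(m : ℝ) ^ 2) ≤ W := by
  have hs : Summable fun m : ℤ => Real.exp (-(m : ℝ) ^ 2) := by
    have h1 : Summable fun k : ℕ => Real.exp (-((k : ℕ) : ℝ) ^ 2) := by
      refine Summable.of_nonneg_of_le (fun _ => (Real.exp_pos _).le) (fun k => ?_)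
        Real.summable_exp_neg_nat
      apply Real.exp_le_exp.2
      rcases Nat.eq_zero_or_pos k with rfl | hk
      · simp
      · have : (1 : ℝ) ≤ k := by exact_mod_cast hk
        nlinarith
    refine Summable.of_nat_of_neg ?_ ?_
    · simpa using h1
    · simpa using h1
  refine ⟨max 1 (∑' m : ℤ, Real.exp (-(m : ℝ) ^ 2)), le_max_left _ _, fun s => ?_⟩
  exact (hs.sum_le_tsum s fun _ _ => (Real.exp_pos _).le).trans (le_max_right _ _)

/-- Integer points of the box `[-L, L]^n` whose coordinates outside `T` have sum of squares at
most `Q`. -/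
def latticePoints (n L : ℕ) (T : Finset (Fin n)) (Q : ℝ) : Finset (Fin n → ℤ) :=
  open Classical in
  (Fintype.piFinset fun _ => Finset.Icc (-(L : ℤ)) L).filter
    fun m => ∑ i ∈ Tᶜ, (m i : ℝ) ^ 2 ≤ Q

/-- The indicator of `∑ m² ≤ Q` is at most `exp(Q - ∑ m²)`, and the sum of this weight factorizes
over the coordinates. Coordinates in `T` carry no weight and contribute the number of integers in
`[-L, L]`. -/
lemma card_latticePoints_le {n L : ℕ} {T : Finset (Fin n)} {Q W : ℝ} (hW1 : 1 ≤ W)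
    (hW : ∀ s : Finset ℤ, ∑ m ∈ s, Real.exp (-(m : ℝ) ^ 2) ≤ W) :
    ((latticePoints n L T Q).card : ℝ) ≤ Real.exp Q * W ^ n * (2 * L + 1) ^ T.card := by
  classical
  set f : Fin n → ℤ → ℝ := fun i m => if i ∈ T then 1 else Real.exp (-(m : ℝ) ^ 2) with hf
  have hf0 : ∀ i m, 0 ≤ f i m := fun i m => by simp only [hf]; split_ifs <;> positivity
  have key : ∀ m ∈ latticePoints n L T Q, (1 : ℝ) ≤ Real.exp Q * ∏ i, f i (m i) := by
    intro m hm
    have hm' := (Finset.mem_filter.1 hm).2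
    have : ∏ i, f i (m i) = Real.exp (-∑ i ∈ Tᶜ, (m i : ℝ) ^ 2) := by
      rw [← Finset.prod_mul_prod_compl T, Finset.prod_congr rfl (g := fun _ => (1 : ℝ)),
        Finset.prod_const_one, one_mul, ← Finset.sum_neg_distrib, Real.exp_sum]
      · exact Finset.prod_congr rfl fun i hi => by simp [hf, Finset.mem_compl.1 hi]
      · intro i hi; simp [hf, hi]
    rw [this, ← Real.exp_add]
    exact Real.one_le_exp (by linarith)
  calc ((latticePoints n L T Q).card : ℝ) = ∑ _m ∈ latticePoints n L T Q, (1 : ℝ) := by simp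
    _ ≤ ∑ m ∈ latticePoints n L T Q, Real.exp Q * ∏ i, f i (m i) := Finset.sum_le_sum key
    _ ≤ ∑ m ∈ Fintype.piFinset fun _ : Fin n => Finset.Icc (-(L : ℤ)) L,
          Real.exp Q * ∏ i, f i (m i) :=
        Finset.sum_le_sum_of_subset_of_nonneg (Finset.filter_subset _ _) fun m _ _ =>
          mul_nonneg (Real.exp_pos _).le (Finset.prod_nonneg fun i _ => hf0 _ _)
    _ = Real.exp Q * ∏ i, ∑ k ∈ Finset.Icc (-(L : ℤ)) L, f i k := by
        rw [← Finset.mul_sum, Finset.prod_univ_sum]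
    _ ≤ Real.exp Q * ∏ i : Fin n, (W * if i ∈ T then (2 * L + 1 : ℝ) else 1) := by
        refine mul_le_mul_of_nonneg_left ?_ (Real.exp_pos _).le
        refine Finset.prod_le_prod (fun i _ => Finset.sum_nonneg fun k _ => hf0 _ _) fun i _ => ?_
        by_cases hi : i ∈ T
        · simp only [hf, hi, if_true, Finset.sum_const, Int.card_Icc, nsmul_eq_mul, mul_one]
          have : (((L : ℤ) + 1 - -(L : ℤ)).toNat : ℝ) = 2 * L + 1 := by
            have : ((L : ℤ) + 1 - -(L : ℤ)).toNat = 2 * L + 1 := by omega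
            rw [this]; push_cast; ring
          rw [this]
          nlinarith [(Nat.cast_nonneg L : (0 : ℝ) ≤ L)]
        · simp only [hf, hi, if_false, mul_one]; exact hW _
    _ = Real.exp Q * W ^ n * (2 * L + 1) ^ T.card := by
        rw [Finset.prod_mul_distrib, Finset.prod_ite_mem]; simp [mul_assoc]

lemma mem_latticePoints {n L : ℕ} {T : Finset (Fin n)} {Q : ℝ} {m : Fin n → ℤ} :
    m ∈ latticePoints n L T Q ↔
      (∀ i, |(m i : ℝ)| ≤ L) ∧ ∑ i ∈ Tᶜ, (m i : ℝ) ^ 2 ≤ Q := by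
  classical
  simp only [latticePoints, Finset.mem_filter, Fintype.mem_piFinset, Finset.mem_Icc]
  refine and_congr_left fun _ => forall_congr' fun i => ?_
  rw [abs_le]
  norm_cast

/-! ### Approximation of a vector through its least common denominator -/

lemma sqrt_posLog_le {x : ℝ} (hx : 0 ≤ x) : Real.sqrt (Real.posLog x) ≤ x := by
  rw [Real.sqrt_le_left hx]
  rcases le_total x 1 with h | h
  · rw [Real.posLog_eq_zero_iff x |>.2 (by rw [abs_of_nonneg hx]; exact h)]; positivity
  · rw [Real.posLog_eq_log (by rwa [abs_of_nonneg hx])]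
    have := Real.log_le_sub_one_of_pos (by linarith : 0 < x)
    nlinarith

lemma rpow_neg_half {a : ℝ} (ha : 0 ≤ a) : a ^ (-(1 / 2) : ℝ) = (Real.sqrt a)⁻¹ := by
  rw [Real.rpow_neg ha, Real.sqrt_eq_rpow]

lemma infDist_intPoints_lt {ι : Type*} [Fintype ι] (x : EuclideanSpace ℝ ι) {r : ℝ}
    (h : Metric.infDist x (intPoints ι) < r) :
    ∃ z : ι → ℤ, ∑ i, (x i - z i) ^ 2 < r ^ 2 := by
  have hne : (intPoints ι).Nonempty := ⟨0, fun i => ⟨0, by simp⟩⟩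
  obtain ⟨y, hy, hd⟩ := (Metric.infDist_lt_iff hne).1 h
  choose z hz using hy
  refine ⟨z, ?_⟩
  rw [EuclideanSpace.dist_eq] at hd
  have h0 : 0 ≤ ∑ i, dist (x i) (y i) ^ 2 := Finset.sum_nonneg fun _ _ => sq_nonneg _
  have := pow_lt_pow_left₀ hd (Real.sqrt_nonneg _) two_ne_zero
  rw [Real.sq_sqrt h0] at this
  simpa [Real.dist_eq, hz] using this

lemma infDist_intPoints_le {ι : Type*} [Fintype ι] (x : EuclideanSpace ℝ ι) :
    Metric.infDist x (intPoints ι) ≤ Real.sqrt (Fintype.card ι) := by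
  have hz : (WithLp.toLp 2 fun i => (⌊x i⌋ : ℝ)) ∈ intPoints ι := fun i => ⟨⌊x i⌋, rfl⟩
  refine (Metric.infDist_le_dist_of_mem hz).trans ?_
  rw [EuclideanSpace.dist_eq]
  refine Real.sqrt_le_sqrt ?_
  calc ∑ i, dist (x i) (⌊x i⌋ : ℝ) ^ 2 ≤ ∑ _i : ι, (1 : ℝ) := by
        refine Finset.sum_le_sum fun i _ => ?_
        rw [Real.dist_eq, sq_abs]
        have h0 := Int.fract_nonneg (x i)
        have h1 := (Int.fract_lt_one (x i)).le
        change (Int.fract (x i)) ^ 2 ≤ 1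
        nlinarith
    _ = Fintype.card ι := by simp

/-- A bound for the infimum defining the least common denominator is a bound for some
denominator. -/
lemma exists_denominator_of_LCD_lt {ι : Type*} [Fintype ι] {δ₀ p : ℝ} (hp : 0 < δ₀ * p)
    (x : EuclideanSpace ℝ ι) {T : ℝ} (h : LCD δ₀ p x < T) :
    ∃ θ, 0 < θ ∧ θ < T ∧ Metric.infDist (θ • x) (intPoints ι) <
      (Real.sqrt (δ₀ * p))⁻¹ * Real.sqrt (Real.posLog (Real.sqrt (δ₀ * p) * θ)) := by
  have hs : 0 < Real.sqrt (δ₀ * p) := Real.sqrt_pos.2 hp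
  -- The real infimum of the empty set is `0`, so a bound on the LCD says nothing until some
  -- denominator exists. Every point is within `√|ι|` of an integer point, while the right side
  -- tends to infinity with `θ`.
  have hne : {θ : ℝ | 0 < θ ∧ Metric.infDist (θ • x) (intPoints ι) <
      (δ₀ * p) ^ (-(1 / 2) : ℝ) * Real.sqrt (Real.posLog (Real.sqrt (δ₀ * p) * θ))}.Nonempty := by
    set u : ℝ := (Fintype.card ι : ℝ) * (δ₀ * p) + 1 with hu
    have hu1 : 1 ≤ u := by rw [hu]; nlinarith [(Nat.cast_nonneg (Fintype.card ι) : (0 : ℝ) ≤ _)]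
    refine ⟨(Real.sqrt (δ₀ * p))⁻¹ * Real.exp u, by positivity, ?_⟩
    refine (infDist_intPoints_le _).trans_lt ?_
    rw [rpow_neg_half hp.le, mul_inv_cancel_left₀ hs.ne', Real.posLog_eq_log
      (by rw [abs_of_pos (Real.exp_pos _)]; exact Real.one_le_exp (by linarith)), Real.log_exp,
      lt_inv_mul_iff₀ hs, ← Real.sqrt_mul hp.le]
    apply Real.sqrt_lt_sqrt (by positivity)
    rw [hu]; linarith
  obtain ⟨θ, ⟨h0, h1⟩, h2⟩ := exists_lt_of_csInf_lt hne h
  exact ⟨θ, h0, h2, by rwa [rpow_neg_half hp.le] at h1⟩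

/-- A vector with small coordinates is close to a multiple of an integer point whose length is
controlled by the least common denominator. -/
lemma exists_int_approx_of_LCD_lt {ι : Type*} [Fintype ι] {δ₀ p : ℝ} (hp : 0 < δ₀ * p)
    (hp1 : δ₀ * p ≤ 1) (x : EuclideanSpace ℝ ι) (hx1 : ‖x‖ ≤ 1) {β T : ℝ}
    (hxβ : ∀ i, |x i| ≤ β) (h : LCD δ₀ p (‖x‖⁻¹ • x) < T) :
    ∃ s : ℝ, 0 ≤ s ∧ s ≤ 1 ∧ ∃ z : ι → ℤ, ∑ i, (z i : ℝ) ^ 2 ≤ 4 * T ^ 2 ∧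
      ∑ i, (x i - s * z i) ^ 2 ≤
        4 * β ^ 2 * (Real.posLog (Real.sqrt (δ₀ * p) * T) / (δ₀ * p)) := by
  have hs : 0 < Real.sqrt (δ₀ * p) := Real.sqrt_pos.2 hp
  by_cases hx0 : x = 0
  · refine ⟨0, le_rfl, zero_le_one, fun _ => 0, ?_, ?_⟩
    · simp only [Int.cast_zero]; simp; positivity
    · simp only [hx0]; simp
      exact mul_nonneg (by positivity) (div_nonneg Real.posLog_nonneg hp.le)
  have hn : 0 < ‖x‖ := norm_pos_iff.2 hx0
  obtain ⟨θ, hθ0, hθT, hd⟩ := exists_denominator_of_LCD_lt hp _ h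
  set A := (Real.sqrt (δ₀ * p))⁻¹ * Real.sqrt (Real.posLog (Real.sqrt (δ₀ * p) * θ)) with hA
  have hA0 : 0 < A := Metric.infDist_nonneg.trans_lt hd
  have hAθ : A ≤ θ := by
    rw [hA, inv_mul_le_iff₀ hs]
    exact sqrt_posLog_le (by positivity)
  obtain ⟨z, hz⟩ := infDist_intPoints_lt _ hd
  -- For `θ < 1` the logarithm is cut off at zero, and no distance is less than `0`.
  have hθ1 : 1 ≤ θ := by
    by_contra hlt
    push Not at hlt
    have h1 : Real.sqrt (δ₀ * p) * θ ≤ 1 :=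
      mul_le_one₀ (Real.sqrt_le_one.2 hp1) hθ0.le hlt.le
    have : Real.posLog (Real.sqrt (δ₀ * p) * θ) = 0 :=
      (Real.posLog_eq_zero_iff _).2 (by rw [abs_of_nonneg (by positivity)]; exact h1)
    rw [hA, this] at hA0
    simp at hA0
  set y : ι → ℝ := fun i => θ * (‖x‖⁻¹ * x i) with hy
  have hz' : ∑ i, (y i - z i) ^ 2 < A ^ 2 := by simpa [hy] using hz
  have hxs : ∑ i, x i ^ 2 = ‖x‖ ^ 2 := by rw [EuclideanSpace.real_norm_sq_eq]
  have hys : ∑ i, y i ^ 2 = θ ^ 2 := by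
    simp only [hy, mul_pow, ← Finset.mul_sum, hxs]
    field_simp
  have hA2 : A ^ 2 ≤ θ ^ 2 := pow_le_pow_left₀ hA0.le hAθ 2
  -- Otherwise `0` is the integer point nearest to `y`, and `θ² = |y|² ≤ |y - z|² < A² ≤ θ²`. This
  -- rules out the trivial approximation `z = 0`.
  have hbig : ∃ i, 1 / 2 ≤ |y i| := by
    by_contra hcon
    push Not at hcon
    have : ∑ i, y i ^ 2 ≤ ∑ i, (y i - z i) ^ 2 := by
      refine Finset.sum_le_sum fun i _ => ?_
      have h1 := abs_lt.1 (hcon i)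
      rcases lt_trichotomy (z i) 0 with hzi | hzi | hzi
      · have : (z i : ℝ) ≤ -1 := by exact_mod_cast (by omega : z i ≤ -1)
        nlinarith
      · simp [hzi]
      · have : (1 : ℝ) ≤ z i := by exact_mod_cast (by omega : 1 ≤ z i)
        nlinarith
    linarith
  -- The coordinate of size at least `1/2` comes from a coordinate of `x` of size at most `β`. The
  -- scale is therefore at most `2β`, which is where the spread of `v` gains a factor `1/M` in the
  -- squared error.
  have hsβ : ‖x‖ / θ ≤ 2 * β := by
    obtain ⟨i, hi⟩ := hbig
    have h1 : |y i| ≤ θ * (‖x‖⁻¹ * β) := by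
      rw [hy]
      simp only [abs_mul, abs_of_pos hθ0, abs_of_pos (inv_pos.2 hn)]
      have := hxβ i
      gcongr
    have h2 : 1 / 2 ≤ θ * β / ‖x‖ := by
      calc 1 / 2 ≤ _ := hi.trans h1
        _ = θ * β / ‖x‖ := by field_simp
    rw [le_div_iff₀ hn] at h2
    rw [div_le_iff₀ hθ0]
    linarith
  refine ⟨‖x‖ / θ, by positivity, (div_le_one hθ0).2 (hx1.trans hθ1), z, ?_, ?_⟩
  · have h1 : ∑ i, (z i : ℝ) ^ 2 ≤ 2 * ∑ i, y i ^ 2 + 2 * ∑ i, (y i - z i) ^ 2 := by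
      rw [Finset.mul_sum, Finset.mul_sum, ← Finset.sum_add_distrib]
      refine Finset.sum_le_sum fun i _ => ?_
      nlinarith [sq_nonneg (2 * y i - z i)]
    have h2 : θ ^ 2 ≤ T ^ 2 := pow_le_pow_left₀ hθ0.le hθT.le 2
    linarith
  · have h1 : ∑ i, (x i - ‖x‖ / θ * z i) ^ 2 = (‖x‖ / θ) ^ 2 * ∑ i, (y i - z i) ^ 2 := by
      rw [Finset.mul_sum]
      refine Finset.sum_congr rfl fun i _ => ?_
      rw [← mul_pow, hy]
      congr 1
      field_simp
    have h2 : A ^ 2 = Real.posLog (Real.sqrt (δ₀ * p) * θ) / (δ₀ * p) := by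
      rw [hA, mul_pow, inv_pow, Real.sq_sqrt hp.le, Real.sq_sqrt Real.posLog_nonneg]
      field_simp
    have h3 : A ^ 2 ≤ Real.posLog (Real.sqrt (δ₀ * p) * T) / (δ₀ * p) := by
      rw [h2]
      refine div_le_div_of_nonneg_right (Real.posLog_le_posLog (by positivity) ?_) hp.le
      gcongr
    have h4 : (‖x‖ / θ) ^ 2 ≤ 4 * β ^ 2 := by
      calc (‖x‖ / θ) ^ 2 ≤ (2 * β) ^ 2 := pow_le_pow_left₀ (by positivity) hsβ 2
        _ = _ := by ring
    rw [h1]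
    exact mul_le_mul h4 (hz'.le.trans h3) (Finset.sum_nonneg fun _ _ => sq_nonneg _)
      (by positivity)

/-! ### The blocks -/

lemma exists_mem_slice {n : ℕ} {S : Finset (Fin n)} {i : Fin n} (hi : i ∈ S) {a k₀ : ℕ}
    (hS : S.card ≤ k₀ * a) : ∃ k < k₀, i ∈ slice S (k * a) ((k + 1) * a) := by
  set r := (S.filter fun j => j < i).card with hr
  have hlt : r < S.card := by
    refine Finset.card_lt_card (Finset.filter_ssubset.2 ⟨i, hi, lt_irrefl i⟩)
  have ha : 0 < a := by
    rcases Nat.eq_zero_or_pos a with rfl | h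
    · simp at hS; simp [hS] at hi
    · exact h
  refine ⟨r / a, (Nat.div_lt_iff_lt_mul ha).2 (hlt.trans_le hS), ?_⟩
  simp only [slice, Finset.mem_filter]
  refine ⟨hi, Nat.div_mul_le_self r a, ?_⟩
  rw [mul_comm]
  exact Nat.lt_mul_div_succ r ha

/-- Both slice lengths are rounded up, so `k₀` slices exhaust `σ` and `σbar`. -/
lemma exists_mem_block {n : ℕ} {M ρ α : ℝ} {σ τ' : Finset (Fin n)}
    (hσ : σ.card = ⌈M * ρ ^ 2 / 2⌉₊) (hk : 0 < numBlocks α σ τ') {i : Fin n}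
    (hi : i ∉ τ' \ σ) : ∃ k < numBlocks α σ τ', i ∈ block M ρ α σ τ' k := by
  set k₀ := numBlocks α σ τ' with hk₀
  have hkR : (0 : ℝ) < k₀ := by exact_mod_cast hk
  by_cases h : i ∈ σ
  · have : σ.card ≤ k₀ * ⌈M * ρ ^ 2 / (2 * k₀)⌉₊ := by
      rw [hσ, Nat.ceil_le]
      push_cast
      calc M * ρ ^ 2 / 2 = k₀ * (M * ρ ^ 2 / (2 * k₀)) := by field_simp
        _ ≤ _ := by gcongr; exact Nat.le_ceil _
    obtain ⟨k, hk1, hk2⟩ := exists_mem_slice h this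
    exact ⟨k, hk1, Finset.mem_union_left _ hk2⟩
  · have h' : i ∈ sigmaBar σ τ' := by
      simp only [sigmaBar, Finset.mem_sdiff, Finset.mem_univ, true_and, Finset.mem_union] at hi ⊢
      tauto
    have : (sigmaBar σ τ').card ≤ k₀ * ⌈((sigmaBar σ τ').card : ℝ) / k₀⌉₊ := by
      have : ((sigmaBar σ τ').card : ℝ) ≤ k₀ * ⌈((sigmaBar σ τ').card : ℝ) / k₀⌉₊ := by
        calc ((sigmaBar σ τ').card : ℝ) = k₀ * ((sigmaBar σ τ').card / k₀) := by field_simp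
          _ ≤ _ := by gcongr; exact Nat.le_ceil _
      exact_mod_cast this
    obtain ⟨k, hk1, hk2⟩ := exists_mem_slice h' this
    exact ⟨k, hk1, Finset.mem_union_right _ hk2⟩

lemma disjoint_block_sdiff {n : ℕ} {M ρ α : ℝ} {σ τ' : Finset (Fin n)} {k : ℕ} {i : Fin n}
    (hi : i ∈ block M ρ α σ τ' k) : i ∉ τ' \ σ := by
  rcases Finset.mem_union.1 hi with h | h
  · exact fun hτ => (Finset.mem_sdiff.1 hτ).2 (Finset.mem_filter.1 h).1
  · exact fun hτ => (Finset.mem_sdiff.1 (Finset.mem_filter.1 h).1).2 (Finset.mem_union_left _ hτ)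

lemma numBlocks_mul_le {n : ℕ} {α : ℝ} (hα : 0 < α) (σ τ' : Finset (Fin n)) (hn : 0 < n) :
    (numBlocks α σ τ' : ℝ) * α ≤ 1 := by
  have hnR : (0 : ℝ) < n := by exact_mod_cast hn
  have hpos : (0 : ℝ) < (⌈α * n⌉₊ : ℝ) := by
    exact_mod_cast Nat.ceil_pos.2 (by positivity)
  have h1 : (numBlocks α σ τ' : ℝ) ≤ n / ⌈α * n⌉₊ := by
    refine Nat.cast_div_le.trans (div_le_div_of_nonneg_right ?_ hpos.le)
    exact_mod_cast Nat.sub_le _ _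
  rw [le_div_iff₀ hpos] at h1
  have h2 := Nat.le_ceil (α * n)
  have h3 : (numBlocks α σ τ' : ℝ) * (α * n) ≤ n :=
    (mul_le_mul_of_nonneg_left h2 (Nat.cast_nonneg _)).trans h1
  nlinarith

lemma norm_restrict_le {n : ℕ} (v : EuclideanSpace ℝ (Fin n)) (I : Finset (Fin n)) :
    ‖restrict v I‖ ≤ ‖v‖ := by
  refine le_of_sq_le_sq ?_ (norm_nonneg _)
  rw [EuclideanSpace.real_norm_sq_eq, EuclideanSpace.real_norm_sq_eq]
  change ∑ i : I, v i ^ 2 ≤ _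
  rw [Finset.sum_coe_sort I fun i => v i ^ 2]
  exact Finset.sum_le_sum_of_subset_of_nonneg (Finset.subset_univ _) fun _ _ _ => sq_nonneg _

lemma exists_int_approx_restrict {n : ℕ} {δ₀ p : ℝ} (hp : 0 < δ₀ * p) (hp1 : δ₀ * p ≤ 1)
    {v : EuclideanSpace ℝ (Fin n)} (hv : ‖v‖ ≤ 1) {I : Finset (Fin n)} {β T : ℝ}
    (hβ : ∀ i ∈ I, |v i| ≤ β) (h : LCD δ₀ p (‖restrict v I‖⁻¹ • restrict v I) < T) :
    ∃ s : ℝ, 0 ≤ s ∧ s ≤ 1 ∧ ∃ z : Fin n → ℤ, ∑ i ∈ I, (z i : ℝ) ^ 2 ≤ 4 * T ^ 2 ∧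
      ∑ i ∈ I, (v i - s * z i) ^ 2 ≤
        4 * β ^ 2 * (Real.posLog (Real.sqrt (δ₀ * p) * T) / (δ₀ * p)) := by
  obtain ⟨s, h0, h1, z, hz1, hz2⟩ := exists_int_approx_of_LCD_lt hp hp1 (restrict v I)
    ((norm_restrict_le v I).trans hv) (β := β) (fun i => hβ i i.2) h
  refine ⟨s, h0, h1, fun i => if hi : i ∈ I then z ⟨i, hi⟩ else 0, ?_, ?_⟩
  · rw [← Finset.sum_coe_sort I]
    simpa using hz1
  · rw [← Finset.sum_coe_sort I]
    simpa [restrict] using hz2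

/-- Each index is charged to the single block named by its label. Disjointness of the blocks is not
needed. -/
lemma sum_label_le {ι : Type*} [DecidableEq ι] {s : Finset ι} {b : ℕ → Finset ι} {k₀ : ℕ}
    {lab : ι → ℕ} (hlab : ∀ i ∈ s, lab i < k₀ ∧ i ∈ b (lab i)) {f : ℕ → ι → ℝ}
    (hf : ∀ k i, 0 ≤ f k i) {c : ℝ} (hc : ∀ k < k₀, ∑ i ∈ b k, f k i ≤ c) :
    ∑ i ∈ s, f (lab i) i ≤ k₀ * c := by
  rw [← Finset.sum_fiberwise_of_maps_to (t := Finset.range k₀) (g := lab)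
    fun i hi => Finset.mem_range.2 (hlab i hi).1]
  calc _ ≤ ∑ k ∈ Finset.range k₀, c := by
        refine Finset.sum_le_sum fun k hk => le_trans ?_ (hc k (Finset.mem_range.1 hk))
        have e : ∑ i ∈ s with lab i = k, f (lab i) i = ∑ i ∈ s with lab i = k, f k i :=
          Finset.sum_congr rfl fun i hi => by rw [(Finset.mem_filter.1 hi).2]
        rw [e]
        refine Finset.sum_le_sum_of_subset_of_nonneg (fun i hi => ?_) fun i _ _ => hf k i
        obtain ⟨h1, h2⟩ := Finset.mem_filter.1 hi
        exact h2 ▸ (hlab i h1).2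
    _ = k₀ * c := by simp

/-! ### The net -/

/-- The number of the first block containing `i`. -/
def blockLabel {n : ℕ} (M ρ α : ℝ) (σ τ' : Finset (Fin n)) (i : Fin n) : ℕ :=
  sInf {k | i ∈ block M ρ α σ τ' k}

/-- A multiple of an integer point on each block, plus a point of the lattice `hℤ^n`. -/
def netPoint {n k : ℕ} (h : ℝ) (lab : Fin n → ℕ) (s : Fin k → ℤ) (z m : Fin n → ℤ) :
    Fin n → ℝ :=
  fun i => (if hk : lab i < k then (s ⟨lab i, hk⟩ : ℝ) else 0) / n ^ 2 * z i + h * m i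

/-- The part of the net belonging to a choice of `σ` and `τ'`. -/
def netPart {n : ℕ} (M ρ α h Q : ℝ) (σ τ' : Finset (Fin n)) : Finset (Fin n → ℝ) :=
  open Classical in
  ((Fintype.piFinset fun _ : Fin (numBlocks α σ τ') => Finset.Icc (0 : ℤ) (n ^ 2)) ×ˢ
    latticePoints n ⌈Q⌉₊ ∅ Q ×ˢ latticePoints n (n + 1) (τ' \ σ) (4 * n)).image
      fun x => netPoint h (blockLabel M ρ α σ τ') x.1 x.2.1 x.2.2

/-- A net for the level sets of the regularized LCD. -/
def net (n : ℕ) (M ρ α h Q : ℝ) : Finset (Fin n → ℝ) :=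
  open Classical in
  (Finset.univ ×ˢ Finset.univ.filter fun τ' : Finset (Fin n) => τ'.card = ⌊M⌋₊).biUnion
    fun x => netPart M ρ α h Q x.1 x.2

/-- The three factors count the rounded scales (at most `1/α` blocks), the integer points `z`, and
the lattice points `m`, which are free on `τ' \ σ`. -/
lemma card_netPart_le {n : ℕ} {M ρ α h Q W : ℝ} (hn : 0 < n) (hα : 0 < α) (hW1 : 1 ≤ W)
    (hW : ∀ s : Finset ℤ, ∑ m ∈ s, Real.exp (-(m : ℝ) ^ 2) ≤ W) {σ τ' : Finset (Fin n)}
    (hτ : τ'.card = ⌊M⌋₊) :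
    ((netPart M ρ α h Q σ τ').card : ℝ) ≤ (n ^ 2 + 1) ^ ⌊1 / α⌋₊ * ((Real.exp Q * W ^ n) *
      (Real.exp (4 * n) * W ^ n * (2 * n + 3) ^ ⌊M⌋₊)) := by
  rw [netPart]
  refine (Nat.cast_le.2 Finset.card_image_le).trans ?_
  rw [Finset.card_product, Finset.card_product, Nat.cast_mul, Nat.cast_mul]
  have h2 : ((Fintype.piFinset fun _ : Fin (numBlocks α σ τ') =>
        Finset.Icc (0 : ℤ) (n ^ 2)).card : ℝ) ≤ (n ^ 2 + 1) ^ ⌊1 / α⌋₊ := by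
    have e : (Fintype.piFinset fun _ : Fin (numBlocks α σ τ') =>
        Finset.Icc (0 : ℤ) (n ^ 2)).card = (n ^ 2 + 1) ^ numBlocks α σ τ' := by
      rw [Fintype.card_piFinset_const, Int.card_Icc]
      congr 1
    rw [e]
    push_cast
    refine pow_le_pow_right₀ (by nlinarith [sq_nonneg (n : ℝ)]) (Nat.le_floor ?_)
    rw [le_div_iff₀ hα]
    exact numBlocks_mul_le hα σ τ' hn
  have h3 := card_latticePoints_le (n := n) (L := ⌈Q⌉₊) (T := ∅) (Q := Q) hW1 hW
  have h4 := card_latticePoints_le (n := n) (L := n + 1) (T := τ' \ σ) (Q := 4 * n) hW1 hW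
  have h5 : (2 * ((n + 1 : ℕ) : ℝ) + 1) ^ (τ' \ σ).card ≤ (2 * n + 3) ^ ⌊M⌋₊ := by
    push_cast
    rw [show (2 * ((n : ℝ) + 1) + 1) = 2 * n + 3 by ring]
    refine pow_le_pow_right₀ (by linarith [(Nat.cast_nonneg n : (0 : ℝ) ≤ n)]) ?_
    rw [← hτ]
    exact Finset.card_le_card Finset.sdiff_subset
  simp only [Finset.card_empty, pow_zero, mul_one] at h3
  have h6 := h4.trans (mul_le_mul_of_nonneg_left h5 (by positivity))
  gcongr

lemma card_net_le {n : ℕ} {M ρ α h Q W : ℝ} (hn : 0 < n) (hα : 0 < α) (hW1 : 1 ≤ W)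
    (hW : ∀ s : Finset ℤ, ∑ m ∈ s, Real.exp (-(m : ℝ) ^ 2) ≤ W) :
    ((net n M ρ α h Q).card : ℝ) ≤ 4 ^ n * ((n ^ 2 + 1) ^ ⌊1 / α⌋₊ * ((Real.exp Q * W ^ n) *
      (Real.exp (4 * n) * W ^ n * (2 * n + 3) ^ ⌊M⌋₊))) := by
  classical
  calc ((net n M ρ α h Q).card : ℝ) ≤ ∑ x ∈ (Finset.univ ×ˢ Finset.univ.filter
        fun τ' : Finset (Fin n) => τ'.card = ⌊M⌋₊ : Finset (Finset (Fin n) × Finset (Fin n))),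
          ((netPart M ρ α h Q x.1 x.2).card : ℝ) := by
        exact_mod_cast Finset.card_biUnion_le
    _ ≤ ∑ _x ∈ (Finset.univ ×ˢ Finset.univ.filter
        fun τ' : Finset (Fin n) => τ'.card = ⌊M⌋₊ : Finset (Finset (Fin n) × Finset (Fin n))),
          (n ^ 2 + 1) ^ ⌊1 / α⌋₊ * ((Real.exp Q * W ^ n) *
          (Real.exp (4 * n) * W ^ n * (2 * n + 3) ^ ⌊M⌋₊)) :=
        Finset.sum_le_sum fun x hx =>
          card_netPart_le hn hα hW1 hW (Finset.mem_filter.1 (Finset.mem_product.1 hx).2).2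
    _ ≤ _ := by
        rw [Finset.sum_const, nsmul_eq_mul]
        refine mul_le_mul_of_nonneg_right ?_ (by positivity)
        rw [Finset.card_product]
        have h1 : (Finset.univ.filter fun τ' : Finset (Fin n) => τ'.card = ⌊M⌋₊).card ≤ 2 ^ n := by
          refine (Finset.card_filter_le _ _).trans ?_
          simp
        have h2 : (Finset.univ : Finset (Finset (Fin n))).card = 2 ^ n := by simp
        rw [h2, show (4 : ℝ) = 2 * 2 by norm_num, mul_pow]
        exact_mod_cast Nat.mul_le_mul_left _ h1

/-- On `σ` the bound is part of the spread condition. Off `τ'` a coordinate is dominated by `⌊M⌋`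
others of a unit vector, which forces the floor in the bound. -/
lemma abs_le_of_notMem_sdiff {n : ℕ} {M ρ : ℝ} {σ τ' : EuclideanSpace ℝ (Fin n) → Finset (Fin n)}
    (hc : IsChoice M ρ σ τ') (hM : 1 ≤ M) {v : EuclideanSpace ℝ (Fin n)} (hv : v ∈ Incomp n M ρ)
    {i : Fin n} (hi : i ∉ τ' v \ σ v) : |v i| ≤ 1 / Real.sqrt ⌊M⌋₊ := by
  have hfl : 0 < ⌊M⌋₊ := Nat.floor_pos.2 hM
  have hflR : (0 : ℝ) < ⌊M⌋₊ := by exact_mod_cast hfl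
  by_cases h : i ∈ σ v
  · have := (Finset.mem_filter.1 (hc.subset_spread v hv h)).2.2
    refine this.trans (one_div_le_one_div_of_le (Real.sqrt_pos.2 hflR) ?_)
    exact Real.sqrt_le_sqrt (Nat.floor_le (by linarith))
  · have hτ : i ∉ τ' v := fun h' => hi (Finset.mem_sdiff.2 ⟨h', h⟩)
    have h1 : ∑ j ∈ τ' v, |v i| ^ 2 ≤ ∑ j, v j ^ 2 := by
      refine (Finset.sum_le_sum (g := fun j => v j ^ 2) fun j hj => ?_).trans
        (Finset.sum_le_sum_of_subset_of_nonneg (Finset.subset_univ _) fun _ _ _ => sq_nonneg _)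
      rw [← sq_abs (v j)]
      exact pow_le_pow_left₀ (abs_nonneg _) (hc.largest v hv j hj i hτ) 2
    rw [← EuclideanSpace.real_norm_sq_eq, hv.1, Finset.sum_const, hc.card_tau v hv,
      nsmul_eq_mul] at h1
    rw [le_div_iff₀ (Real.sqrt_pos.2 hflR)]
    refine le_of_sq_le_sq ?_ zero_le_one
    rw [mul_pow, Real.sq_sqrt hflR.le]
    linarith

/-- The hypothesis `herr` adds up, over at most `1/α` blocks, the LCD approximation error and the
error of rounding the scales to multiples of `n⁻²`. Asking for `h²n` makes the lattice part `m`
satisfy `∑ m² ≤ 4n` off `τ`. The matrix `A` is arbitrary and influences only which net point is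
picked. -/
lemma exists_mem_net {n : ℕ} {δ₀ p M ρ α h Q D : ℝ}
    {σ τ' : EuclideanSpace ℝ (Fin n) → Finset (Fin n)} (hc : IsChoice M ρ σ τ') (hn : 0 < n)
    (hp : 0 < δ₀ * p) (hp1 : δ₀ * p ≤ 1) (hM : 1 ≤ M) (hα : 0 < α) (hh : 0 < h)
    (hhn : 1 ≤ h * n) (hD : 0 < D) (hQ : 1 / α * (64 * D ^ 2) ≤ Q)
    (herr : 1 / α * (8 * (1 / ⌊M⌋₊) * (Real.posLog (Real.sqrt (δ₀ * p) * (4 * D)) / (δ₀ * p))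
      + 128 * D ^ 2 / n ^ 4) ≤ h ^ 2 * n)
    (A : Matrix (Fin n) (Fin n) ℝ) {v : EuclideanSpace ℝ (Fin n)}
    (hv : v ∈ levelSet δ₀ p M ρ α σ τ' D) :
    ∃ x ∈ net n M ρ α h Q, (∀ i, |v i - x i| ≤ h) ∧
      ∑ i, (A *ᵥ fun j => v j - x j) i ^ 2 ≤ h ^ 2 * ∑ i, ∑ j, A i j ^ 2 := by
  classical
  obtain ⟨hvI, hv1, hv2⟩ := hv
  have hnR : (0 : ℝ) < n := by exact_mod_cast hn
  have hnR1 : (1 : ℝ) ≤ n := by exact_mod_cast hn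
  set S := σ v with hS
  set T := τ' v with hT
  set k₀ := numBlocks α S T with hk₀
  -- With no blocks the supremum defining the regularized LCD is `0`, contrary to `D > 0`.
  have hk : 0 < k₀ := by
    rcases Nat.eq_zero_or_pos k₀ with h0 | h0
    · exfalso
      have : IsEmpty (Fin (numBlocks α S T)) := by rw [← hk₀, h0]; infer_instance
      rw [regLCD, Real.iSup_of_isEmpty] at hv1
      linarith
    · exact h0
  have hkα : (k₀ : ℝ) ≤ 1 / α := by
    rw [le_div_iff₀ hα]; exact numBlocks_mul_le hα S T hn
  have hLCD : ∀ k < k₀, LCD δ₀ p (‖restrict v (block M ρ α S T k)‖⁻¹ •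
      restrict v (block M ρ α S T k)) < 4 * D := by
    intro k hk
    refine lt_of_le_of_lt (le_trans ?_ hv2) (by linarith : 2 * D < 4 * D)
    exact le_ciSup (f := fun k : Fin (numBlocks α S T) => LCD δ₀ p
      (‖restrict v (block M ρ α S T k)‖⁻¹ • restrict v (block M ρ α S T k)))
      (Set.finite_range _).bddAbove ⟨k, hk⟩
  set β : ℝ := 1 / Real.sqrt ⌊M⌋₊ with hβ
  have hβ2 : β ^ 2 = 1 / ⌊M⌋₊ := by rw [hβ, div_pow, Real.sq_sqrt (Nat.cast_nonneg _), one_pow]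
  set P := Real.posLog (Real.sqrt (δ₀ * p) * (4 * D)) / (δ₀ * p) with hP
  have hblock : ∀ k, ∃ s : ℝ, 0 ≤ s ∧ s ≤ 1 ∧ ∃ z : Fin n → ℤ, k < k₀ →
      (∑ i ∈ block M ρ α S T k, (z i : ℝ) ^ 2 ≤ 4 * (4 * D) ^ 2 ∧
      ∑ i ∈ block M ρ α S T k, (v i - s * z i) ^ 2 ≤ 4 * β ^ 2 * P) := by
    intro k
    by_cases hk : k < k₀
    · obtain ⟨s, h0, h1, z, h2, h3⟩ := exists_int_approx_restrict hp hp1 hvI.1.le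
        (β := β) (fun i hi => abs_le_of_notMem_sdiff hc hM hvI (disjoint_block_sdiff hi))
        (hLCD k hk)
      exact ⟨s, h0, h1, z, fun _ => ⟨h2, h3⟩⟩
    · exact ⟨0, le_rfl, zero_le_one, fun _ => 0, fun h => absurd h hk⟩
  choose s hs0 hs1 Z hZ using hblock
  set lab := blockLabel M ρ α S T with hlab
  have hlab' : ∀ i ∈ (T \ S)ᶜ, lab i < k₀ ∧ i ∈ block M ρ α S T (lab i) := by
    intro i hi
    obtain ⟨k, hk1, hk2⟩ := exists_mem_block (M := M) (ρ := ρ) (hc.card_sigma v hvI) hk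
      (Finset.mem_compl.1 hi)
    exact ⟨(Nat.sInf_le hk2).trans_lt hk1,
      Nat.sInf_mem (s := {k | i ∈ block M ρ α S T k}) ⟨k, hk2⟩⟩
  set sI : ℕ → ℤ := fun k => ⌊s k * n ^ 2⌋ with hsI
  have hsI0 : ∀ k, 0 ≤ sI k := fun k => Int.floor_nonneg.2 (mul_nonneg (hs0 k) (by positivity))
  have hsI1 : ∀ k, sI k ≤ n ^ 2 := fun k => by
    have : ((sI k : ℤ) : ℝ) ≤ ((n ^ 2 : ℤ) : ℝ) := by
      push_cast
      refine (Int.floor_le _).trans ?_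
      nlinarith [hs1 k, sq_nonneg (n : ℝ)]
    exact_mod_cast this
  have hsI2 : ∀ k, (s k - sI k / n ^ 2) ^ 2 ≤ 1 / n ^ 4 := fun k => by
    have h1 := Int.floor_le (s k * n ^ 2)
    have h2 := (Int.lt_floor_add_one (s k * n ^ 2)).le
    have e : s k - sI k / n ^ 2 = (s k * n ^ 2 - sI k) / n ^ 2 := by field_simp
    rw [e, div_pow, ← pow_mul]
    refine div_le_div_of_nonneg_right ?_ (by positivity)
    nlinarith
  -- Indices in `τ` lie in no block and have a default label. With `z = 0` there the scale does not
  -- matter, and `v` is approximated by the lattice `hℤⁿ` alone.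
  set z : Fin n → ℤ := fun i => if i ∈ T \ S then 0 else Z (lab i) i with hz
  have hzc : ∀ i ∈ (T \ S)ᶜ, z i = Z (lab i) i := fun i hi =>
    if_neg (Finset.mem_compl.1 hi)
  have hzT : ∀ i ∈ T \ S, z i = 0 := fun i hi => if_pos hi
  have hzsum : ∑ i, (z i : ℝ) ^ 2 ≤ Q := by
    have h1 : ∑ i, (z i : ℝ) ^ 2 = ∑ i ∈ (T \ S)ᶜ, (Z (lab i) i : ℝ) ^ 2 := by
      rw [← Finset.sum_add_sum_compl (T \ S),
        Finset.sum_eq_zero (fun i hi => by simp [hzT i hi]), zero_add]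
      exact Finset.sum_congr rfl fun i hi => by rw [hzc i hi]
    rw [h1]
    refine (sum_label_le hlab' (f := fun k i => (Z k i : ℝ) ^ 2) (fun _ _ => sq_nonneg _)
      fun k hk => (hZ k hk).1).trans (le_trans ?_ hQ)
    rw [show 4 * (4 * D) ^ 2 = 64 * D ^ 2 by ring]
    gcongr
  set y : Fin n → ℝ := fun i => (if lab i < k₀ then (sI (lab i) : ℝ) else 0) / n ^ 2 * z i with hy
  set w : Fin n → ℝ := fun i => v i - y i with hw
  have hwsum : ∑ i ∈ (T \ S)ᶜ, w i ^ 2 ≤ h ^ 2 * n := by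
    have h1 : ∀ i ∈ (T \ S)ᶜ, w i ^ 2 ≤
        2 * (v i - s (lab i) * Z (lab i) i) ^ 2 + 2 / n ^ 4 * (Z (lab i) i : ℝ) ^ 2 := by
      intro i hi
      have e : w i = (v i - s (lab i) * Z (lab i) i) +
          (s (lab i) - sI (lab i) / n ^ 2) * Z (lab i) i := by
        simp only [hw, hy, hzc i hi, if_pos (hlab' i hi).1]; ring
      rw [e]
      have h2 := mul_le_mul_of_nonneg_right (hsI2 (lab i)) (sq_nonneg (Z (lab i) i : ℝ))
      rw [← mul_pow] at h2
      have h3 := add_sq_le (a := v i - s (lab i) * Z (lab i) i)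
        (b := (s (lab i) - sI (lab i) / n ^ 2) * Z (lab i) i)
      have h4 : 2 / (n : ℝ) ^ 4 * (Z (lab i) i : ℝ) ^ 2 =
        2 * (1 / n ^ 4 * (Z (lab i) i : ℝ) ^ 2) := by ring
      rw [h4]
      linarith
    refine (Finset.sum_le_sum h1).trans ((sum_label_le hlab'
      (f := fun k i => 2 * (v i - s k * Z k i) ^ 2 + 2 / n ^ 4 * (Z k i : ℝ) ^ 2)
      (fun _ _ => by positivity) (c := 8 * (1 / ⌊M⌋₊) * P + 128 * D ^ 2 / n ^ 4)
      fun k hk => ?_).trans (le_trans ?_ herr))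
    · rw [Finset.sum_add_distrib, ← Finset.mul_sum, ← Finset.mul_sum]
      have h5 := (hZ k hk).2
      rw [hβ2] at h5
      have h6 := mul_le_mul_of_nonneg_left (hZ k hk).1 (by positivity : 0 ≤ 2 / (n : ℝ) ^ 4)
      have e : 2 / (n : ℝ) ^ 4 * (4 * (4 * D) ^ 2) = 128 * D ^ 2 / n ^ 4 := by ring
      linarith
    · have hP0 : 0 ≤ P := div_nonneg Real.posLog_nonneg hp.le
      gcongr
  -- On `τ` one has `|w| = |v| ≤ 1 ≤ hn`; elsewhere `w² ≤ h²n ≤ (hn)²`. After rounding this gives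
  -- the box of side `n + 1` in `netPart`.
  have hwabs : ∀ i, |w i| ≤ h * n := by
    intro i
    by_cases hi : i ∈ T \ S
    · have e : w i = v i := by simp [hw, hy, hzT i hi]
      rw [e]
      have : |v i| ≤ 1 := by
        have := PiLp.norm_apply_le v i
        rwa [hvI.1] at this
      linarith
    · refine abs_le_of_sq_le_sq ?_ (by positivity)
      have := Finset.single_le_sum (f := fun i => w i ^ 2) (fun _ _ => sq_nonneg _)
        (Finset.mem_compl.2 hi)
      refine (this.trans hwsum).trans ?_
      rw [mul_pow]
      gcongr
      nlinarith
  obtain ⟨m, hm1, hm2⟩ := exists_rounding A w hh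
  refine ⟨netPoint h lab (fun k : Fin k₀ => sI k) z m, ?_, ?_, ?_⟩
  · rw [net, Finset.mem_biUnion]
    refine ⟨(S, T), ?_, ?_⟩
    · simp [hT, hc.card_tau v hvI]
    · rw [netPart, Finset.mem_image]
      refine ⟨(fun k : Fin k₀ => sI k, z, m), ?_, rfl⟩
      rw [Finset.mem_product, Finset.mem_product]
      refine ⟨Fintype.mem_piFinset.2 fun k => Finset.mem_Icc.2 ⟨hsI0 k, hsI1 k⟩,
        mem_latticePoints.2 ⟨fun i => ?_, ?_⟩, mem_latticePoints.2 ⟨fun i => ?_, ?_⟩⟩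
      · have h1 : |(z i : ℝ)| ≤ (z i : ℝ) ^ 2 := by
          have : |z i| ≤ z i ^ 2 :=
            abs_le.2 ⟨by linarith [Int.le_self_sq (-z i), neg_sq (z i)], Int.le_self_sq _⟩
          exact_mod_cast this
        have h2 := Finset.single_le_sum (f := fun i => (z i : ℝ) ^ 2) (fun _ _ => sq_nonneg _)
          (Finset.mem_univ i)
        exact (h1.trans (h2.trans hzsum)).trans (Nat.le_ceil _)
      · simpa using hzsum
      · have h1 : |h * m i| ≤ h * n + h := by
          have := abs_sub_abs_le_abs_sub (h * (m i : ℝ)) (w i)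
          rw [abs_sub_comm (h * (m i : ℝ))] at this
          linarith [hm1 i, hwabs i]
        rw [abs_mul, abs_of_pos hh] at h1
        push_cast
        nlinarith
      -- Summing gives `h² ∑ m² ≤ 2h²n + 2h²n`, the source of the radius `4n`.
      · have h1 : ∀ i ∈ (T \ S)ᶜ, h ^ 2 * (m i : ℝ) ^ 2 ≤ 2 * w i ^ 2 + 2 * h ^ 2 := by
          intro i _
          have h2 : (w i - h * m i) ^ 2 ≤ h ^ 2 := by
            rw [← sq_abs]; exact pow_le_pow_left₀ (abs_nonneg _) (hm1 i) 2
          nlinarith [sq_nonneg (2 * w i - h * m i)]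
        have h2 := Finset.sum_le_sum h1
        rw [← Finset.mul_sum, Finset.sum_add_distrib, ← Finset.mul_sum, Finset.sum_const,
          nsmul_eq_mul] at h2
        have h3 : ((T \ S)ᶜ.card : ℝ) ≤ n := by
          exact_mod_cast (Finset.card_le_univ _).trans_eq (Fintype.card_fin n)
        have hh2 : 0 < h ^ 2 := by positivity
        nlinarith
  all_goals
    have e : ∀ i, v i - netPoint h lab (fun k : Fin k₀ => sI k) z m i = w i - h * m i := by
      intro i
      simp only [netPoint, hw, hy, dite_eq_ite]
      ring
    simp_rw [e]
    assumption

/-! ### The entries -/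

/-- Products of pairs of jointly independent variables are independent. -/
lemma iIndepFun_mul_of_sumElim {Ω E : Type*} [MeasurableSpace Ω] [Fintype E] {μ : Measure Ω}
    [IsProbabilityMeasure μ] {η ξ : E → Ω → ℝ} (hη : ∀ e, Measurable (η e))
    (hξ : ∀ e, Measurable (ξ e)) (h : iIndepFun (Sum.elim η ξ) μ) :
    iIndepFun (fun e ω => η e ω * ξ e ω) μ := by
  have hm : ∀ x, AEMeasurable (Sum.elim η ξ x) μ := by
    rintro (e | e)
    exacts [(hη e).aemeasurable, (hξ e).aemeasurable]
  have hpair : iIndepFun (fun e ω => (η e ω, ξ e ω)) μ := by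
    rw [iIndepFun_iff_map_fun_eq_pi_map fun e => ((hη e).prodMk (hξ e)).aemeasurable]
    have hη' : ∀ e, IsProbabilityMeasure (μ.map (η e)) :=
      fun e => Measure.isProbabilityMeasure_map (hη e).aemeasurable
    have hξ' : ∀ e, IsProbabilityMeasure (μ.map (ξ e)) :=
      fun e => Measure.isProbabilityMeasure_map (hξ e).aemeasurable
    have hs : ∀ x, IsProbabilityMeasure (μ.map (Sum.elim η ξ x)) :=
      fun x => Measure.isProbabilityMeasure_map (hm x)
    have h1 : ∀ e, μ.map (fun ω => (η e ω, ξ e ω)) = (μ.map (η e)).prod (μ.map (ξ e)) := fun e =>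
      (indepFun_iff_map_prod_eq_prod_map_map (hη e).aemeasurable (hξ e).aemeasurable).1
        (h.indepFun (i := Sum.inl e) (j := Sum.inr e) (by simp))
    simp_rw [h1]
    -- The joint law is a product measure over `E ⊕ E`. It is regrouped first as a product of two
    -- product measures, then as a product over `E` of the laws of pairs.
    have h2 := (measurePreserving_sumPiEquivProdPi fun x => μ.map (Sum.elim η ξ x)).map_eq
    rw [← h.map_fun_eq_pi_map hm, Measure.map_map (MeasurableEquiv.measurable _)
      (by rw [measurable_pi_iff]; rintro (e | e); exacts [hη e, hξ e])] at h2
    have h3 := (measurePreserving_arrowProdEquivProdArrow ℝ ℝ E (fun e => μ.map (η e))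
      fun e => μ.map (ξ e)).symm.map_eq
    have h4 : (Measure.pi fun e => μ.map (Sum.elim η ξ (Sum.inl e))).prod
        (Measure.pi fun e => μ.map (Sum.elim η ξ (Sum.inr e))) =
        (Measure.pi fun e => μ.map (η e)).prod (Measure.pi fun e => μ.map (ξ e)) := rfl
    rw [← h3, ← h4, ← h2, Measure.map_map (MeasurableEquiv.measurable _)
      ((MeasurableEquiv.measurable _).comp
        (by rw [measurable_pi_iff]; rintro (e | e); exacts [hη e, hξ e]))]
    rfl
  exact hpair.comp (fun _ x => x.1 * x.2) fun _ => measurable_fst.mul measurable_snd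

/-- Layer-cake formula for `X²`: the exponent `a = 1/(2B²)` is half the tail rate, so the integral
is at most `∫ 2a exp(-at) dt = 2`. -/
lemma lintegral_exp_sq_sub_one_le {Ω : Type*} [MeasurableSpace Ω] {μ : Measure Ω} {X : Ω → ℝ}
    (hX : Measurable X) {B : ℝ} (hB : 0 < B) (h : SubgaussianMomentLE X B μ) :
    ∫⁻ ω, ENNReal.ofReal (Real.exp (X ω ^ 2 / (2 * B ^ 2)) - 1) ∂μ ≤ 2 := by
  set a : ℝ := 1 / (2 * B ^ 2) with ha
  have ha0 : 0 < a := by positivity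
  have hcont : Continuous fun t : ℝ => a * Real.exp (a * t) := by fun_prop
  have hint : ∀ u : ℝ, ∫ t in (0 : ℝ)..u, a * Real.exp (a * t) = Real.exp (a * u) - 1 := by
    intro u
    rw [intervalIntegral.integral_eq_sub_of_hasDerivAt (f := fun t => Real.exp (a * t))
      (fun x _ => ?_) (hcont.intervalIntegrable _ _)]
    · simp
    · have := ((hasDerivAt_id x).const_mul a).exp
      simpa [mul_comm] using this
  have h1 := lintegral_comp_eq_lintegral_meas_lt_mul μ (f := fun ω => X ω ^ 2)
    (g := fun t => a * Real.exp (a * t)) (Filter.Eventually.of_forall fun ω => sq_nonneg _)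
    (hX.pow_const 2).aemeasurable (fun t _ => hcont.intervalIntegrable _ _)
    (Filter.Eventually.of_forall fun t => by positivity)
  simp_rw [hint] at h1
  have e : ∀ ω, X ω ^ 2 / (2 * B ^ 2) = a * X ω ^ 2 := fun ω => by rw [ha]; ring
  simp_rw [e]
  rw [h1]
  calc ∫⁻ t in Set.Ioi 0, μ {ω | t < X ω ^ 2} * ENNReal.ofReal (a * Real.exp (a * t))
      ≤ ∫⁻ t in Set.Ioi (0 : ℝ), ENNReal.ofReal (2 * a * Real.exp (-a * t)) := by
        refine setLIntegral_mono' measurableSet_Ioi fun t ht => ?_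
        have ht : 0 < t := ht
        have h2 : μ {ω | t < X ω ^ 2} ≤ ENNReal.ofReal (2 * Real.exp (-(2 * a * t))) := by
          have h3 := h (Real.sqrt t) (Real.sqrt_pos.2 ht)
          rw [Real.sq_sqrt ht.le, show t / B ^ 2 = 2 * a * t by rw [ha]; field_simp] at h3
          refine (measure_mono fun ω hω => ?_).trans h3
          simp only [Set.mem_ofPred_eq] at hω ⊢
          rw [← Real.sqrt_sq_eq_abs]
          exact Real.sqrt_lt_sqrt ht.le hω
        refine (mul_le_mul_left h2 _).trans ?_
        rw [← ENNReal.ofReal_mul (by positivity)]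
        refine ENNReal.ofReal_le_ofReal (le_of_eq ?_)
        rw [show 2 * Real.exp (-(2 * a * t)) * (a * Real.exp (a * t)) =
          2 * a * (Real.exp (-(2 * a * t)) * Real.exp (a * t)) by ring, ← Real.exp_add]
        ring_nf
    _ = ENNReal.ofReal (∫ t in Set.Ioi (0 : ℝ), 2 * a * Real.exp (-a * t)) := by
        rw [ofReal_integral_eq_lintegral_ofReal]
        · exact ((integrableOn_exp_mul_Ioi (by linarith : -a < 0) 0).const_mul (2 * a))
        · exact Filter.Eventually.of_forall fun t => by positivity
    _ = 2 := by
        rw [integral_const_mul, integral_exp_mul_Ioi (by linarith : -a < 0)]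
        simp only [mul_zero, Real.exp_zero]
        rw [show 2 * a * (-1 / -a) = 2 by field_simp]
        simp

/-- The moment bounds which follow from the subgaussian tail. -/
lemma integrable_exp_sq {Ω : Type*} [MeasurableSpace Ω] {μ : Measure Ω} [IsProbabilityMeasure μ]
    {X : Ω → ℝ} (hX : Measurable X) {B : ℝ} (hB : 0 < B) (h : SubgaussianMomentLE X B μ) :
    Integrable (fun ω => Real.exp (X ω ^ 2 / (2 * B ^ 2)) - 1) μ ∧
      ∫ ω, (Real.exp (X ω ^ 2 / (2 * B ^ 2)) - 1) ∂μ ≤ 2 := by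
  have h1 := lintegral_exp_sq_sub_one_le hX hB h
  have hm : Measurable fun ω => Real.exp (X ω ^ 2 / (2 * B ^ 2)) - 1 := by fun_prop
  have h0 : ∀ ω, 0 ≤ Real.exp (X ω ^ 2 / (2 * B ^ 2)) - 1 := fun ω =>
    sub_nonneg.2 (Real.one_le_exp (by positivity))
  refine ⟨⟨hm.aestronglyMeasurable, ?_⟩, ?_⟩
  · rw [hasFiniteIntegral_iff_ofReal (Filter.Eventually.of_forall h0)]
    exact h1.trans_lt (by simp)
  · rw [integral_eq_lintegral_of_nonneg_ae (Filter.Eventually.of_forall h0)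
      hm.aestronglyMeasurable]
    exact ENNReal.toReal_le_of_le_ofReal (by norm_num) (by simpa using h1)

lemma integrable_pow_four {Ω : Type*} [MeasurableSpace Ω] {μ : Measure Ω}
    [IsProbabilityMeasure μ] {X : Ω → ℝ} (hX : Measurable X) {B : ℝ} (hB : 0 < B)
    (h : SubgaussianMomentLE X B μ) :
    Integrable (fun ω => X ω ^ 4) μ ∧ ∫ ω, X ω ^ 4 ∂μ ≤ 24 * B ^ 4 := by
  obtain ⟨h1, h2⟩ := integrable_exp_sq hX hB h
  have hle : ∀ ω, X ω ^ 4 ≤ 8 * B ^ 4 * (Real.exp (X ω ^ 2 / (2 * B ^ 2)) - 1 + 1) := by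
    intro ω
    have h3 := Real.quadratic_le_exp_of_nonneg (by positivity : 0 ≤ X ω ^ 2 / (2 * B ^ 2))
    have h4 : 0 ≤ X ω ^ 2 / (2 * B ^ 2) := by positivity
    have e : X ω ^ 4 = 8 * B ^ 4 * ((X ω ^ 2 / (2 * B ^ 2)) ^ 2 / 2) := by field_simp; ring
    rw [e]
    refine mul_le_mul_of_nonneg_left ?_ (by positivity)
    linarith
  have hint : Integrable (fun ω => 8 * B ^ 4 * (Real.exp (X ω ^ 2 / (2 * B ^ 2)) - 1 + 1)) μ :=
    (h1.add (integrable_const 1)).const_mul _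
  have hi : Integrable (fun ω => X ω ^ 4) μ := by
    refine hint.mono' (hX.pow_const 4).aestronglyMeasurable (Filter.Eventually.of_forall fun ω => ?_)
    rw [Real.norm_of_nonneg (by positivity)]
    exact hle ω
  refine ⟨hi, (integral_mono hi hint hle).trans ?_⟩
  rw [integral_const_mul, integral_add h1 (integrable_const 1)]
  simp only [integral_const, probReal_univ, smul_eq_mul, mul_one]
  nlinarith [pow_pos hB 4]

lemma norm_exp_mul_I_sub_le (x : ℝ) :
    ‖Complex.exp (x * Complex.I) - 1 - x * Complex.I + x ^ 2 / 2‖ ≤ 4 * |x| ^ 3 := by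
  rcases le_total |x| 1 with h | h
  · have hn : ‖(x : ℂ) * Complex.I‖ = |x| := by simp
    have := Complex.exp_bound (x := x * Complex.I) (by rw [hn]; exact h) (n := 3) (by norm_num)
    rw [hn] at this
    have e : Complex.exp (x * Complex.I) - ∑ m ∈ Finset.range 3, (x * Complex.I) ^ m / m.factorial
        = Complex.exp (x * Complex.I) - 1 - x * Complex.I + x ^ 2 / 2 := by
      simp only [Finset.sum_range_succ, Finset.sum_range_zero, mul_pow, Complex.I_sq]
      norm_num [Nat.factorial]
      ring
    rw [e] at this
    refine this.trans ?_
    norm_num [Nat.factorial]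
    nlinarith [pow_nonneg (abs_nonneg x) 3]
  · have h1 : ‖Complex.exp (x * Complex.I) - 1 - x * Complex.I + x ^ 2 / 2‖ ≤
        1 + 1 + |x| + |x| ^ 2 / 2 := by
      refine (norm_add_le _ _).trans (add_le_add ((norm_sub_le _ _).trans (add_le_add
        ((norm_sub_le _ _).trans (add_le_add ?_ ?_)) ?_)) ?_)
      · rw [Complex.norm_exp_ofReal_mul_I]
      · simp
      · simp
      · simp
    refine h1.trans ?_
    have h2 : |x| ^ 2 ≤ |x| ^ 3 := pow_le_pow_right₀ h (by norm_num)
    have h3 : |x| ≤ |x| ^ 3 := le_self_pow₀ h (by norm_num)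
    nlinarith

section Entries

variable {Ω : Type*} [MeasurableSpace Ω] {μ : Measure Ω} {n : ℕ}
  {p B : ℝ} {η ξ : Sym2 (Fin n) → Ω → ℝ}

/-- Because `η` takes the values `0` and `1` and `f` vanishes at `0`, almost surely `f(ηξ) = η
f(ξ)`; independence then yields the factor `p`. Later uses subtract `1` from an exponential to
arrange `f(0) = 0`. -/
lemma IsSparseEntries.integral_comp (H : IsSparseEntries μ n p B η ξ) (hp : 0 ≤ p)
    (e : Sym2 (Fin n)) {𝕜 : Type*} [RCLike 𝕜] {f : ℝ → 𝕜} (hf : Measurable f) (hf0 : f 0 = 0) :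
    ∫ ω, f (η e ω * ξ e ω) ∂μ = (p : 𝕜) * ∫ ω, f (ξ e ω) ∂μ := by
  have h1 : ∫ ω, f (η e ω * ξ e ω) ∂μ = ∫ ω, ((η e ω : ℝ) : 𝕜) * f (ξ e ω) ∂μ := by
    refine integral_congr_ae ?_
    filter_upwards [H.zero_or_one e] with ω hω
    rcases hω with h | h <;> simp [h, hf0]
  have hind : IndepFun (fun ω => ((η e ω : ℝ) : 𝕜)) (fun ω => f (ξ e ω)) μ :=
    (H.indep.indepFun (i := Sum.inl e) (j := Sum.inr e) (by simp)).comp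
      RCLike.measurable_ofReal hf
  rw [h1, hind.integral_fun_mul_eq_mul_integral
    (RCLike.measurable_ofReal.comp (H.measurable_η e)).aestronglyMeasurable
    (hf.comp (H.measurable_ξ e)).aestronglyMeasurable, integral_ofReal]
  congr 2
  have h2 : ∫ ω, η e ω ∂μ = ∫ ω, ({ω | η e ω = 1} : Set Ω).indicator (fun _ => (1 : ℝ)) ω ∂μ := by
    refine integral_congr_ae ?_
    filter_upwards [H.zero_or_one e] with ω hω
    rcases hω with h | h <;> simp [Set.indicator, h]
  have hs : MeasurableSet {ω | η e ω = 1} := H.measurable_η e (measurableSet_singleton 1)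
  rw [h2, integral_indicator_const _ hs, measureReal_def]
  simp [H.prob_one e, hp]

/-- The excess of the exponential moment over `1` is proportional to `p`. This is what makes the
Hilbert-Schmidt tail bound work at the sparse scale `pn²`. -/
lemma IsSparseEntries.integral_exp_sq [IsProbabilityMeasure μ]
    (H : IsSparseEntries μ n p B η ξ) (hB : 0 < B)
    (hp : 0 ≤ p) (e : Sym2 (Fin n)) :
    Integrable (fun ω => Real.exp ((η e ω * ξ e ω) ^ 2 / (2 * B ^ 2))) μ ∧
      ∫ ω, Real.exp ((η e ω * ξ e ω) ^ 2 / (2 * B ^ 2)) ∂μ ≤ Real.exp (2 * p) := by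
  obtain ⟨h1, h2⟩ := integrable_exp_sq (H.measurable_ξ e) hB (H.subgaussian e)
  have hm : Measurable fun ω => Real.exp ((η e ω * ξ e ω) ^ 2 / (2 * B ^ 2)) := by
    have := H.measurable_η e
    have := H.measurable_ξ e
    fun_prop
  have hint : Integrable (fun ω => Real.exp ((η e ω * ξ e ω) ^ 2 / (2 * B ^ 2))) μ := by
    refine (h1.add (integrable_const 1)).mono' hm.aestronglyMeasurable ?_
    filter_upwards [H.zero_or_one e] with ω hω
    rw [Real.norm_of_nonneg (Real.exp_pos _).le]
    rcases hω with h | h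
    · simp [h]; positivity
    · simp [h]
  refine ⟨hint, ?_⟩
  have h3 := H.integral_comp hp e (f := fun x : ℝ => Real.exp (x ^ 2 / (2 * B ^ 2)) - 1)
    (by fun_prop) (by simp)
  rw [integral_sub hint (integrable_const 1)] at h3
  simp only [integral_const, probReal_univ, smul_eq_mul, mul_one, RCLike.ofReal_real_eq_id,
    id] at h3
  have := Real.add_one_le_exp (2 * p)
  nlinarith

/-- Decay of the characteristic function of an entry near zero. -/
lemma IsSparseEntries.norm_integral_exp_le [IsProbabilityMeasure μ]
    (H : IsSparseEntries μ n p B η ξ) (hB : 0 < B)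
    (hp : 0 ≤ p) (hp1 : p ≤ 1) (e : Sym2 (Fin n)) {θ : ℝ}
    (hθ : 16 * (1 + 24 * B ^ 4) * |θ| ≤ 1) :
    ‖∫ ω, Complex.exp ((θ * (η e ω * ξ e ω) : ℝ) * Complex.I) ∂μ‖ ≤
      Real.exp (-(p * θ ^ 2 / 4)) := by
  have hmη := H.measurable_η e
  have hmξ := H.measurable_ξ e
  obtain ⟨h4i, h4⟩ := integrable_pow_four hmξ hB (H.subgaussian e)
  set X := ξ e with hX
  have hbd : ∀ {k : ℕ} (_ : k ≤ 4) (ω : Ω), |X ω| ^ k ≤ 1 + X ω ^ 4 := by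
    intro k hk ω
    have e4 : X ω ^ 4 = |X ω| ^ 4 := by rw [Even.pow_abs (by decide)]
    rcases le_total |X ω| 1 with h | h
    · exact (pow_le_one₀ (abs_nonneg _) h).trans (by rw [e4]; linarith [pow_nonneg (abs_nonneg (X ω)) 4])
    · rw [e4]; linarith [pow_le_pow_right₀ h hk]
  have hint4 : Integrable (fun ω => 1 + X ω ^ 4) μ := (integrable_const 1).add h4i
  have hik : ∀ {k : ℕ} (_ : k ≤ 4), Integrable (fun ω => X ω ^ k) μ := fun {k} hk =>
    hint4.mono' (hmξ.pow_const k).aestronglyMeasurable (Filter.Eventually.of_forall fun ω => by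
      rw [norm_pow, Real.norm_eq_abs]; exact hbd hk ω)
  have h3i : Integrable (fun ω => |X ω| ^ 3) μ := by
    refine hint4.mono' ?_ (Filter.Eventually.of_forall fun ω => ?_)
    · exact (continuous_abs.measurable.comp hmξ |>.pow_const 3).aestronglyMeasurable
    · rw [norm_pow, Real.norm_eq_abs, abs_abs]; exact hbd (by norm_num) ω
  have h3 : ∫ ω, |X ω| ^ 3 ∂μ ≤ 1 + 24 * B ^ 4 := by
    refine (integral_mono h3i hint4 fun ω => hbd (by norm_num) ω).trans ?_
    rw [integral_add (integrable_const 1) h4i]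
    simpa using h4
  have h2 : ∫ ω, X ω ^ 2 ∂μ = 1 := by
    have hv := H.variance_one e
    rw [variance_eq_integral hmξ.aemeasurable, H.mean_zero e] at hv
    simpa using hv
  have h1 : ∫ ω, X ω ∂μ = 0 := H.mean_zero e
  set R : ℂ := ∫ ω, (Complex.exp ((θ * X ω : ℝ) * Complex.I) - 1 - (θ * X ω : ℝ) * Complex.I
    + (θ * X ω : ℝ) ^ 2 / 2) ∂μ with hR
  have hRle : ‖R‖ ≤ 4 * |θ| ^ 3 * (1 + 24 * B ^ 4) := by
    refine (norm_integral_le_integral_norm _).trans ?_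
    have : ∫ ω, 4 * |θ| ^ 3 * |X ω| ^ 3 ∂μ ≤ 4 * |θ| ^ 3 * (1 + 24 * B ^ 4) := by
      rw [integral_const_mul]
      exact mul_le_mul_of_nonneg_left h3 (by positivity)
    refine le_trans (integral_mono_of_nonneg (Filter.Eventually.of_forall fun _ => norm_nonneg _)
      (h3i.const_mul _) (Filter.Eventually.of_forall fun ω => ?_)) this
    refine (norm_exp_mul_I_sub_le (θ * X ω)).trans (le_of_eq ?_)
    rw [abs_mul]; ring
  have hexpi : Integrable (fun ω => Complex.exp ((θ * X ω : ℝ) * Complex.I)) μ := by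
    refine (integrable_const (1 : ℝ)).mono' ?_ (Filter.Eventually.of_forall fun ω => ?_)
    · exact (by fun_prop : Measurable _).aestronglyMeasurable
    · rw [Complex.norm_exp_ofReal_mul_I]
  have hξc : ∫ ω, (Complex.exp ((θ * X ω : ℝ) * Complex.I) - 1) ∂μ = R - (θ : ℂ) ^ 2 / 2 := by
    have i1 : Integrable (fun ω => ((θ * X ω : ℝ) : ℂ) * Complex.I) μ := by
      have : Integrable (fun ω => θ * X ω) μ := by
        simpa using (hik (k := 1) (by norm_num)).const_mul θ
      exact this.ofReal.mul_const _
    have i2 : Integrable (fun ω => ((θ * X ω : ℝ) : ℂ) ^ 2 / 2) μ := by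
      have : Integrable (fun ω => (θ * X ω) ^ 2) μ := by
        simpa [mul_pow] using (hik (k := 2) (by norm_num)).const_mul (θ ^ 2)
      simpa using this.ofReal.div_const (2 : ℂ)
    have j1 : ∫ ω, ((θ * X ω : ℝ) : ℂ) * Complex.I ∂μ = 0 := by
      rw [integral_mul_const, integral_complex_ofReal, integral_const_mul, h1]; simp
    have j2 : ∫ ω, ((θ * X ω : ℝ) : ℂ) ^ 2 / 2 ∂μ = (θ : ℂ) ^ 2 / 2 := by
      rw [integral_div]
      simp_rw [← Complex.ofReal_pow]
      rw [integral_complex_ofReal]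
      simp_rw [mul_pow]
      rw [integral_const_mul, h2]; simp
    have i3 : Integrable (fun ω => Complex.exp ((θ * X ω : ℝ) * Complex.I) - 1) μ :=
      hexpi.sub (integrable_const 1)
    have i4 : Integrable (fun ω => Complex.exp ((θ * X ω : ℝ) * Complex.I) - 1 -
        ((θ * X ω : ℝ) : ℂ) * Complex.I) μ := i3.sub i1
    rw [hR, integral_add i4 i2, integral_sub i3 i1, j1, j2]
    ring
  -- Sparsification turns the characteristic function `φ` of `ξ` into `1 + p(φ - 1)`. With `φ = 1 -
  -- θ²/2 + R`, the assumption on `θ` makes `|R| ≤ θ²/4`, half of the quadratic term.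
  have hc := H.integral_comp hp e (f := fun x : ℝ => Complex.exp ((θ * x : ℝ) * Complex.I) - 1)
    (by fun_prop) (by simp)
  have hexpi' : Integrable (fun ω => Complex.exp ((θ * (η e ω * X ω) : ℝ) * Complex.I)) μ := by
    refine (integrable_const (1 : ℝ)).mono' ?_ (Filter.Eventually.of_forall fun ω => ?_)
    · exact (by fun_prop : Measurable _).aestronglyMeasurable
    · rw [Complex.norm_exp_ofReal_mul_I]
  rw [hξc, integral_sub hexpi' (integrable_const 1)] at hc
  simp only [integral_const, probReal_univ, one_smul] at hc
  have hval : ∫ ω, Complex.exp ((θ * (η e ω * X ω) : ℝ) * Complex.I) ∂μ =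
      ((1 - p * θ ^ 2 / 2 : ℝ) : ℂ) + (p : ℝ) * R := by
    rw [sub_eq_iff_eq_add] at hc
    rw [hc]
    push_cast
    simp only [Complex.coe_algebraMap]
    ring
  have hB4 : 0 < B ^ 4 := by positivity
  have hθ1 : |θ| ≤ 1 := by nlinarith [abs_nonneg θ]
  have hθ2 : θ ^ 2 ≤ 1 := by rw [← sq_abs]; nlinarith [abs_nonneg θ]
  rw [hval]
  calc _ ≤ |1 - p * θ ^ 2 / 2| + p * (4 * |θ| ^ 3 * (1 + 24 * B ^ 4)) := by
        refine (norm_add_le _ _).trans (add_le_add ?_ ?_)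
        · rw [Complex.norm_real, Real.norm_eq_abs]
        · rw [norm_mul, Complex.norm_real, Real.norm_of_nonneg hp]
          exact mul_le_mul_of_nonneg_left hRle hp
    _ ≤ 1 - p * θ ^ 2 / 2 + p * (θ ^ 2 / 4) := by
        rw [abs_of_nonneg (by nlinarith [sq_nonneg θ])]
        refine add_le_add le_rfl (mul_le_mul_of_nonneg_left ?_ hp)
        have e1 : 4 * |θ| ^ 3 * (1 + 24 * B ^ 4) =
          |θ| ^ 2 / 4 * (16 * (1 + 24 * B ^ 4) * |θ|) := by ring
        rw [e1, sq_abs]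
        nlinarith [sq_nonneg θ]
    _ = 1 - p * θ ^ 2 / 4 := by ring
    _ ≤ Real.exp (-(p * θ ^ 2 / 4)) := by
        have := Real.add_one_le_exp (-(p * θ ^ 2 / 4)); linarith

end Entries

/-! ### Small ball probability -/

lemma integral_exp_sum_gaussian {ι : Type*} [Fintype ι] (y : ι → ℝ) :
    ∫ g : ι → ℝ, Complex.exp ((∑ i, g i * y i : ℝ) * Complex.I)
      ∂(Measure.pi fun _ => gaussianReal 0 1) = (Real.exp (-(∑ i, y i ^ 2) / 2) : ℝ) := by
  have h1 : ∀ g : ι → ℝ, Complex.exp ((∑ i, g i * y i : ℝ) * Complex.I) =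
      ∏ i, Complex.exp (y i * g i * Complex.I) := by
    intro g
    rw [← Complex.exp_sum]
    push_cast
    rw [Finset.sum_mul]
    exact congrArg _ (Finset.sum_congr rfl fun i _ => by ring)
  simp_rw [h1]
  rw [integral_fintype_prod_eq_prod (f := fun i (g : ℝ) => Complex.exp (y i * g * Complex.I))]
  simp_rw [← charFun_apply_real, charFun_gaussianReal]
  rw [← Complex.exp_sum]
  push_cast
  congr 1
  rw [neg_div, Finset.sum_div, ← Finset.sum_neg_distrib]
  exact Finset.sum_congr rfl fun i _ => by simp

/-- The characteristic function of a linear combination of the entries in terms of the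
characteristic functions of the entries. -/
lemma norm_integral_exp_sum_eq {Ω E : Type*} [MeasurableSpace Ω] [Fintype E] {μ : Measure Ω}
    [IsProbabilityMeasure μ] {X : E → Ω → ℝ} (hX : ∀ e, Measurable (X e)) (h : iIndepFun X μ)
    (c : E → ℝ) (d : ℝ) :
    ‖∫ ω, Complex.exp ((∑ e, c e * X e ω + d : ℝ) * Complex.I) ∂μ‖ =
      ∏ e, ‖∫ ω, Complex.exp ((c e * X e ω : ℝ) * Complex.I) ∂μ‖ := by
  have h1 : ∀ ω, Complex.exp ((∑ e, c e * X e ω + d : ℝ) * Complex.I) =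
      (∏ e, Complex.exp ((c e * X e ω : ℝ) * Complex.I)) * Complex.exp (d * Complex.I) := by
    intro ω
    rw [← Complex.exp_sum, ← Complex.exp_add]
    push_cast
    rw [add_mul, Finset.sum_mul]
  simp_rw [h1]
  rw [integral_mul_const, norm_mul, Complex.norm_exp_ofReal_mul_I, mul_one,
    h.integral_fun_prod_comp (f := fun e x => Complex.exp ((c e * x : ℝ) * Complex.I))
      (fun e => (hX e).aemeasurable)
      (fun e => (by fun_prop : Measurable _).aestronglyMeasurable), norm_prod]

section SmallBall

variable {Ω : Type*} [MeasurableSpace Ω] {μ : Measure Ω} [IsProbabilityMeasure μ] {n : ℕ}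
  {X : Sym2 (Fin n) → Ω → ℝ}

/-- Only the rows outside `J` and the columns in `J` are used to bound the characteristic
function of a combination of the rows. -/
lemma norm_integral_exp_rows_le (hX : ∀ e, Measurable (X e)) (h : iIndepFun X μ)
    (J : Finset (Fin n)) (x : Fin n → ℝ) (lam b : ℝ) (g : ↥Jᶜ → ℝ) :
    ‖∫ ω, Complex.exp ((∑ i : ↥Jᶜ, g i * (b * (∑ j, X s(↑i, j) ω * x j - lam * x i)) : ℝ) *
      Complex.I) ∂μ‖ ≤
      ∏ i : ↥Jᶜ, ∏ j ∈ J, ‖∫ ω, Complex.exp ((g i * (b * x j) * X s(↑i, j) ω : ℝ) *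
        Complex.I) ∂μ‖ := by
  classical
  set c : Sym2 (Fin n) → ℝ := fun e =>
    ∑ i : ↥Jᶜ, ∑ j, if s(↑i, j) = e then g i * (b * x j) else 0 with hc
  have h1 : ∀ ω, ∑ i : ↥Jᶜ, g i * (b * (∑ j, X s(↑i, j) ω * x j - lam * x i)) =
      ∑ e, c e * X e ω + -(∑ i : ↥Jᶜ, g i * (b * (lam * x i))) := by
    intro ω
    have : ∑ e, c e * X e ω = ∑ i : ↥Jᶜ, ∑ j, g i * (b * x j) * X s(↑i, j) ω := by
      simp only [hc, Finset.sum_mul]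
      rw [Finset.sum_comm]
      refine Finset.sum_congr rfl fun i _ => ?_
      rw [Finset.sum_comm]
      refine Finset.sum_congr rfl fun j _ => ?_
      simp [ite_mul]
    rw [this, ← sub_eq_add_neg, ← Finset.sum_sub_distrib]
    refine Finset.sum_congr rfl fun i _ => ?_
    rw [mul_sub, mul_sub, Finset.mul_sum, Finset.mul_sum]
    congr 1
    exact Finset.sum_congr rfl fun j _ => by ring
  simp_rw [h1]
  rw [norm_integral_exp_sum_eq hX h c]
  -- Symmetry of the matrix is harmless here: a position with row outside `J` and column in `J` is
  -- determined by its unordered pair, so these entries are independent and each coefficient below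
  -- has a single term.
  have hinj : ∀ a ∈ (Finset.univ : Finset ↥Jᶜ) ×ˢ J, ∀ a' ∈ (Finset.univ : Finset ↥Jᶜ) ×ˢ J,
      s((a.1 : Fin n), a.2) = s((a'.1 : Fin n), a'.2) → a = a' := by
    rintro ⟨i, j⟩ hij ⟨i', j'⟩ hij' heq
    have hj := (Finset.mem_product.1 hij).2
    have hj' := (Finset.mem_product.1 hij').2
    rcases Sym2.eq_iff.1 heq with ⟨h1, h2⟩ | ⟨h1, h2⟩
    · exact Prod.ext (Subtype.ext h1) h2
    · exact absurd (show (i : Fin n) ∈ J by rw [show (i : Fin n) = j' from h1]; exact hj')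
        (Finset.mem_compl.1 i.2)
  have hcval : ∀ i : ↥Jᶜ, ∀ j ∈ J, c s(↑i, j) = g i * (b * x j) := by
    intro i j hj
    simp only [hc]
    rw [Finset.sum_eq_single i, Finset.sum_eq_single j]
    · simp
    · intro j' _ hne
      rw [if_neg]
      intro heq
      rcases Sym2.eq_iff.1 heq with ⟨-, h2⟩ | ⟨h1, h2⟩
      · exact hne h2
      · exact Finset.mem_compl.1 i.2 (h1 ▸ hj)
    · simp
    · intro i' _ hne
      refine Finset.sum_eq_zero fun j' _ => ?_
      rw [if_neg]
      intro heq
      rcases Sym2.eq_iff.1 heq with ⟨h1, -⟩ | ⟨h1, -⟩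
      · exact hne (Subtype.ext h1)
      · exact Finset.mem_compl.1 i'.2 (h1 ▸ hj)
    · simp
  have hle1 : ∀ e, ‖∫ ω, Complex.exp ((c e * X e ω : ℝ) * Complex.I) ∂μ‖ ≤ 1 := fun e => by
    refine (norm_integral_le_integral_norm _).trans ?_
    simp_rw [Complex.norm_exp_ofReal_mul_I]
    simp
  rw [← Finset.prod_product']
  calc _ ≤ ∏ e ∈ ((Finset.univ : Finset ↥Jᶜ) ×ˢ J).image fun a => s((a.1 : Fin n), a.2),
        ‖∫ ω, Complex.exp ((c e * X e ω : ℝ) * Complex.I) ∂μ‖ :=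
        by
          rw [← Finset.prod_mul_prod_compl
            (((Finset.univ : Finset ↥Jᶜ) ×ˢ J).image fun a => s((a.1 : Fin n), a.2))]
          exact mul_le_of_le_one_right (Finset.prod_nonneg fun _ _ => norm_nonneg _)
            (Finset.prod_le_one (fun _ _ => norm_nonneg _) fun e _ => hle1 e)
    _ = _ := by
        rw [Finset.prod_image hinj]
        refine Finset.prod_congr rfl fun a ha => ?_
        rw [hcval a.1 a.2 (Finset.mem_product.1 ha).2]

/-- Gaussian linearization: `exp(-|L|²/2)` is the average of `exp(i⟨g, L⟩)` over a standard Gaussian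
`g`. After Fubini, the bound on the characteristic function is a product over rows, and so is its
Gaussian average. -/
lemma integral_exp_neg_sq_rows_le (hX : ∀ e, Measurable (X e)) (h : iIndepFun X μ)
    (J : Finset (Fin n)) (x : Fin n → ℝ) (lam b : ℝ) {ψ : ℝ → ℝ}
    (hψi : Integrable ψ (gaussianReal 0 1))
    (hψ : ∀ i ∉ J, ∀ t : ℝ, ∏ j ∈ J, ‖∫ ω, Complex.exp ((t * (b * x j) * X s(i, j) ω : ℝ) *
        Complex.I) ∂μ‖ ≤ ψ t) :
    ∫ ω, Real.exp (-(∑ i : ↥Jᶜ, (b * (∑ j, X s(↑i, j) ω * x j - lam * x i)) ^ 2) / 2) ∂μ ≤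
      (∫ t, ψ t ∂(gaussianReal 0 1)) ^ Jᶜ.card := by
  set L : ↥Jᶜ → Ω → ℝ := fun i ω => b * (∑ j, X s(↑i, j) ω * x j - lam * x i) with hL
  have hLm : ∀ i, Measurable (L i) := fun i => by fun_prop
  set γ : Measure (↥Jᶜ → ℝ) := Measure.pi fun _ => gaussianReal 0 1 with hγ
  have hswap : ∫ ω, ∫ g : ↥Jᶜ → ℝ, Complex.exp ((∑ i, g i * L i ω : ℝ) * Complex.I) ∂γ ∂μ =
      ∫ g : ↥Jᶜ → ℝ, ∫ ω, Complex.exp ((∑ i, g i * L i ω : ℝ) * Complex.I) ∂μ ∂γ := by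
    refine integral_integral_swap ?_
    refine (integrable_const (1 : ℝ)).mono' ?_ (Filter.Eventually.of_forall fun z => ?_)
    · refine Measurable.aestronglyMeasurable ?_
      simp only [Function.uncurry_def]
      fun_prop
    · simp only [Function.uncurry_def]
      rw [Complex.norm_exp_ofReal_mul_I]
  have hgauss : ∀ ω, ∫ g : ↥Jᶜ → ℝ, Complex.exp ((∑ i, g i * L i ω : ℝ) * Complex.I) ∂γ =
      (Real.exp (-(∑ i, L i ω ^ 2) / 2) : ℝ) := fun ω => integral_exp_sum_gaussian _
  simp_rw [hgauss] at hswap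
  rw [integral_complex_ofReal] at hswap
  have hpos : 0 ≤ ∫ ω, Real.exp (-(∑ i : ↥Jᶜ, L i ω ^ 2) / 2) ∂μ :=
    integral_nonneg fun _ => (Real.exp_pos _).le
  calc ∫ ω, Real.exp (-(∑ i : ↥Jᶜ, L i ω ^ 2) / 2) ∂μ
      = ‖((∫ ω, Real.exp (-(∑ i : ↥Jᶜ, L i ω ^ 2) / 2) ∂μ : ℝ) : ℂ)‖ := by
        rw [Complex.norm_real, Real.norm_of_nonneg hpos]
    _ ≤ ∫ g : ↥Jᶜ → ℝ, ‖∫ ω, Complex.exp ((∑ i, g i * L i ω : ℝ) * Complex.I) ∂μ‖ ∂γ := by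
        rw [hswap]; exact norm_integral_le_integral_norm _
    _ ≤ ∫ g : ↥Jᶜ → ℝ, ∏ i, ψ (g i) ∂γ := by
        refine integral_mono_of_nonneg (Filter.Eventually.of_forall fun _ => norm_nonneg _)
          (Integrable.fintype_prod (f := fun _ => ψ) fun _ => hψi)
          (Filter.Eventually.of_forall fun g => ?_)
        refine (norm_integral_exp_rows_le hX h J x lam b g).trans ?_
        exact Finset.prod_le_prod (fun _ _ => Finset.prod_nonneg fun _ _ => norm_nonneg _)
          fun i _ => hψ i (Finset.mem_compl.1 i.2) (g i)
    _ = _ := by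
        rw [hγ, integral_fintype_prod_eq_prod (f := fun _ => ψ)]
        simp

end SmallBall

lemma integral_exp_neg_mul_sq_gaussian_le {κ : ℝ} (hκ : 0 < κ) :
    Integrable (fun t => Real.exp (-κ * t ^ 2)) (gaussianReal 0 1) ∧
      ∫ t, Real.exp (-κ * t ^ 2) ∂(gaussianReal 0 1) ≤ 1 / Real.sqrt (2 * κ) := by
  constructor
  · refine (integrable_const (1 : ℝ)).mono' (by fun_prop : Measurable _).aestronglyMeasurable
      (Filter.Eventually.of_forall fun t => ?_)
    rw [Real.norm_of_nonneg (Real.exp_pos _).le]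
    exact Real.exp_le_one_iff.2 (by nlinarith [sq_nonneg t])
  · rw [integral_gaussianReal_eq_integral_smul one_ne_zero]
    calc ∫ t, gaussianPDFReal 0 1 t • Real.exp (-κ * t ^ 2)
        ≤ ∫ t, (Real.sqrt (2 * Real.pi))⁻¹ * Real.exp (-κ * t ^ 2) := by
          refine integral_mono_of_nonneg (Filter.Eventually.of_forall fun t => ?_)
            ((integrable_exp_neg_mul_sq hκ).const_mul _) (Filter.Eventually.of_forall fun t => ?_)
          · exact mul_nonneg (gaussianPDFReal_nonneg _ _ _) (Real.exp_pos _).le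
          · refine mul_le_mul_of_nonneg_right ?_ (Real.exp_pos _).le
            rw [gaussianPDFReal_def]
            simp only [NNReal.coe_one, mul_one]
            refine mul_le_of_le_one_right (by positivity) (Real.exp_le_one_iff.2 ?_)
            exact div_nonpos_of_nonpos_of_nonneg (by nlinarith [sq_nonneg (t - 0)]) (by norm_num)
      _ = 1 / Real.sqrt (2 * κ) := by
          rw [integral_const_mul, integral_gaussian, ← Real.sqrt_inv, ← Real.sqrt_mul (by positivity),
            one_div, ← Real.sqrt_inv]
          congr 1
          field_simp

lemma integral_sq_gaussian :
    Integrable (fun t : ℝ => t ^ 2) (gaussianReal 0 1) ∧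
      ∫ t, t ^ 2 ∂(gaussianReal 0 1) = 1 := by
  constructor
  · exact (memLp_id_gaussianReal 2).integrable_sq
  · have := variance_fun_id_gaussianReal (μ := 0) (v := 1)
    rw [variance_eq_integral (by fun_prop), integral_id_gaussianReal] at this
    simpa using this

/-- Small ball probability for a vector with a set `J` of spread coordinates. -/
lemma IsSparseEntries.measure_norm_le_le {Ω : Type*} [MeasurableSpace Ω] {μ : Measure Ω}
    [IsProbabilityMeasure μ] {n : ℕ} {p B : ℝ} {η ξ : Sym2 (Fin n) → Ω → ℝ}
    (H : IsSparseEntries μ n p B η ξ) (hB : 0 < B) (hp : 0 < p) (hp1 : p ≤ 1) (hn : 0 < n)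
    {J : Finset (Fin n)} (hJ : J.Nonempty) {x : Fin n → ℝ} {lo hi T : ℝ} (hlo : 0 < lo)
    (hT : 0 < T) (hxlo : ∀ j ∈ J, lo ≤ |x j|) (hxhi : ∀ j ∈ J, |x j| ≤ hi) (lam : ℝ) :
    μ {ω | ∑ i, ((sparseMatrix η ξ ω - lam • (1 : Matrix (Fin n) (Fin n) ℝ)) *ᵥ x) i ^ 2 ≤ T ^ 2}
      ≤ ENNReal.ofReal (Real.exp (n / 2) * (1 / Real.sqrt (p * n * J.card * lo ^ 2 / (2 * T ^ 2)) +
        (16 * (1 + 24 * B ^ 4)) ^ 2 * hi ^ 2 * n / T ^ 2) ^ Jᶜ.card) := by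
  set X : Sym2 (Fin n) → Ω → ℝ := fun e ω => η e ω * ξ e ω with hX
  have hXm : ∀ e, Measurable (X e) := fun e => (H.measurable_η e).mul (H.measurable_ξ e)
  have hXi : iIndepFun X μ := iIndepFun_mul_of_sumElim H.measurable_η H.measurable_ξ H.indep
  have hnR : (0 : ℝ) < n := by exact_mod_cast hn
  have hJR : (0 : ℝ) < J.card := by exact_mod_cast hJ.card_pos
  set C : ℝ := 16 * (1 + 24 * B ^ 4) with hC
  have hC0 : 0 < C := by positivity
  -- With this scaling the event forces `∑ (bL)² ≤ n`, hence `F ≥ exp(-n/2)`; Markov's inequality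
  -- then costs the factor `exp(n/2)`.
  set b : ℝ := Real.sqrt n / T with hb
  have hb0 : 0 < b := by positivity
  have hb2 : b ^ 2 = n / T ^ 2 := by rw [hb, div_pow, Real.sq_sqrt hnR.le]
  set κ : ℝ := p * n * J.card * lo ^ 2 / (4 * T ^ 2) with hκ
  have hκ0 : 0 < κ := by positivity
  set D : ℝ := C ^ 2 * hi ^ 2 * n / T ^ 2 with hD
  have hD0 : 0 ≤ D := by positivity
  -- The first term is the decay valid for small `t`. Beyond that range `D t² ≥ 1` dominates the
  -- trivial bound, and its Gaussian average is just `D`.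
  set ψ : ℝ → ℝ := fun t => Real.exp (-κ * t ^ 2) + D * t ^ 2 with hψ
  obtain ⟨hi1, hi2⟩ := integral_exp_neg_mul_sq_gaussian_le hκ0
  have hψi : Integrable ψ (gaussianReal 0 1) := hi1.add (integral_sq_gaussian.1.const_mul D)
  have hψint : ∫ t, ψ t ∂(gaussianReal 0 1) ≤
      1 / Real.sqrt (p * n * J.card * lo ^ 2 / (2 * T ^ 2)) + D := by
    rw [hψ, integral_add hi1 (integral_sq_gaussian.1.const_mul D), integral_const_mul,
      integral_sq_gaussian.2, mul_one]
    have e : p * n * J.card * lo ^ 2 / (2 * T ^ 2) = 2 * κ := by rw [hκ]; ring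
    rw [e]
    linarith
  have hψ0 : 0 ≤ ∫ t, ψ t ∂(gaussianReal 0 1) := integral_nonneg fun t => by positivity
  have hbound : ∀ i ∉ J, ∀ t : ℝ, ∏ j ∈ J, ‖∫ ω, Complex.exp ((t * (b * x j) * X s(i, j) ω : ℝ) *
        Complex.I) ∂μ‖ ≤ ψ t := by
    intro i _ t
    have hnorm1 : ∀ j, ‖∫ ω, Complex.exp ((t * (b * x j) * X s(i, j) ω : ℝ) *
        Complex.I) ∂μ‖ ≤ 1 := fun j => by
      refine (norm_integral_le_integral_norm _).trans ?_
      simp_rw [Complex.norm_exp_ofReal_mul_I]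
      simp
    by_cases ht : C * (|t| * (b * hi)) ≤ 1
    · have h1 : ∀ j ∈ J, ‖∫ ω, Complex.exp ((t * (b * x j) * X s(i, j) ω : ℝ) *
          Complex.I) ∂μ‖ ≤ Real.exp (-(p * (b ^ 2 * lo ^ 2) * t ^ 2 / 4)) := by
        intro j hj
        refine (H.norm_integral_exp_le hB hp.le hp1 s(i, j) (θ := t * (b * x j)) ?_).trans ?_
        · rw [abs_mul, abs_mul, abs_of_pos hb0]
          refine le_trans ?_ ht
          have := hxhi j hj
          gcongr
        · refine Real.exp_le_exp.2 (neg_le_neg ?_)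
          have h2 : lo ^ 2 ≤ x j ^ 2 := by
            rw [← sq_abs (x j)]; exact pow_le_pow_left₀ hlo.le (hxlo j hj) 2
          rw [mul_pow, mul_pow]
          have h3 : p * (b ^ 2 * lo ^ 2) * t ^ 2 ≤ p * (b ^ 2 * x j ^ 2) * t ^ 2 := by gcongr
          linarith
      refine (Finset.prod_le_prod (fun _ _ => norm_nonneg _) h1).trans ?_
      rw [Finset.prod_const, ← Real.exp_nat_mul, hψ]
      have e : (J.card : ℝ) * -(p * (b ^ 2 * lo ^ 2) * t ^ 2 / 4) = -κ * t ^ 2 := by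
        rw [hb2, hκ]; ring
      rw [e]
      have : 0 ≤ D * t ^ 2 := by positivity
      simpa using this
    · refine (Finset.prod_le_one (fun _ _ => norm_nonneg _) fun j _ => hnorm1 j).trans ?_
      push Not at ht
      have h1 : 1 ≤ (C * (|t| * (b * hi))) ^ 2 := by nlinarith
      have e : (C * (|t| * (b * hi))) ^ 2 = D * t ^ 2 := by
        rw [hD, mul_pow C, mul_pow |t|, mul_pow b, sq_abs, hb2]; ring
      rw [e] at h1
      have : 0 ≤ Real.exp (-κ * t ^ 2) := (Real.exp_pos _).le
      simp only [hψ]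
      linarith
  have hmain := integral_exp_neg_sq_rows_le hXm hXi J x lam b hψi hbound
  set F : Ω → ℝ := fun ω =>
    Real.exp (-(∑ i : ↥Jᶜ, (b * (∑ j, X s(↑i, j) ω * x j - lam * x i)) ^ 2) / 2) with hF
  have hFm : Measurable F := by fun_prop
  have hFi : Integrable F μ := by
    refine (integrable_const (1 : ℝ)).mono' hFm.aestronglyMeasurable
      (Filter.Eventually.of_forall fun ω => ?_)
    rw [Real.norm_of_nonneg (Real.exp_pos _).le]
    refine Real.exp_le_one_iff.2 (div_nonpos_of_nonpos_of_nonneg (neg_nonpos.2 ?_) (by norm_num))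
    exact Finset.sum_nonneg fun _ _ => sq_nonneg _
  have hmarkov := mul_meas_ge_le_integral_of_nonneg
    (Filter.Eventually.of_forall fun ω => (Real.exp_pos _).le : 0 ≤ᵐ[μ] F) hFi
    (Real.exp (-(n / 2 : ℝ)))
  have hsub : {ω | ∑ i, ((sparseMatrix η ξ ω - lam • (1 : Matrix (Fin n) (Fin n) ℝ)) *ᵥ x) i ^ 2
      ≤ T ^ 2} ⊆ {ω | Real.exp (-(n / 2 : ℝ)) ≤ F ω} := by
    intro ω hω
    rw [Set.mem_ofPred_eq] at hω ⊢
    refine Real.exp_le_exp.2 ?_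
    have e : ∀ i, ((sparseMatrix η ξ ω - lam • (1 : Matrix (Fin n) (Fin n) ℝ)) *ᵥ x) i =
        ∑ j, X s(i, j) ω * x j - lam * x i := by
      intro i
      rw [Matrix.sub_mulVec, Matrix.smul_mulVec, Matrix.one_mulVec]
      simp [Matrix.mulVec, dotProduct, sparseMatrix, hX]
    simp_rw [e] at hω
    have h1 : ∑ i : ↥Jᶜ, (b * (∑ j, X s(↑i, j) ω * x j - lam * x i)) ^ 2 ≤ n := by
      rw [Finset.sum_coe_sort Jᶜ fun i => (b * (∑ j, X s(i, j) ω * x j - lam * x i)) ^ 2]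
      simp_rw [mul_pow]
      rw [← Finset.mul_sum, hb2]
      have h2 : ∑ i ∈ Jᶜ, (∑ j, X s(i, j) ω * x j - lam * x i) ^ 2 ≤ T ^ 2 :=
        (Finset.sum_le_sum_of_subset_of_nonneg (Finset.subset_univ _)
          fun _ _ _ => sq_nonneg _).trans hω
      calc _ ≤ n / T ^ 2 * T ^ 2 := by gcongr
        _ = n := by field_simp
    linarith
  refine (measure_mono hsub).trans ?_
  rw [← ENNReal.ofReal_toReal (measure_ne_top μ _)]
  refine ENNReal.ofReal_le_ofReal ?_
  rw [← measureReal_def]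
  have h5 : (∫ t, ψ t ∂(gaussianReal 0 1)) ^ Jᶜ.card ≤
      (1 / Real.sqrt (p * n * J.card * lo ^ 2 / (2 * T ^ 2)) + D) ^ Jᶜ.card :=
    pow_le_pow_left₀ hψ0 hψint _
  have h6 := hmarkov.trans (hmain.trans h5)
  have h7 := mul_le_mul_of_nonneg_left h6 (Real.exp_pos (n / 2 : ℝ)).le
  rwa [← mul_assoc, ← Real.exp_add, add_neg_cancel, Real.exp_zero, one_mul] at h7

/-! ### The Hilbert-Schmidt norm -/

/-- Exponential Markov inequality with exponent `1/(2B²)`: the moment is at most `exp(2pn²)`, since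
there are at most `n²` unordered pairs, and the threshold is `exp(3pn²)`. -/
lemma IsSparseEntries.measure_sum_sq_ge_le {Ω : Type*} [MeasurableSpace Ω] {μ : Measure Ω}
    [IsProbabilityMeasure μ] {n : ℕ} {p B : ℝ} {η ξ : Sym2 (Fin n) → Ω → ℝ}
    (H : IsSparseEntries μ n p B η ξ) (hB : 0 < B) (hp : 0 ≤ p) (hn : 0 < n) :
    μ {ω | 6 * B ^ 2 * (p * n ^ 2) ≤ ∑ e, (η e ω * ξ e ω) ^ 2} ≤
      ENNReal.ofReal (Real.exp (-(p * n ^ 2))) := by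
  set X : Sym2 (Fin n) → Ω → ℝ := fun e ω => η e ω * ξ e ω with hX
  have hXm : ∀ e, Measurable (X e) := fun e => (H.measurable_η e).mul (H.measurable_ξ e)
  have hXi : iIndepFun X μ := iIndepFun_mul_of_sumElim H.measurable_η H.measurable_ξ H.indep
  set Y : Sym2 (Fin n) → Ω → ℝ := fun e ω => Real.exp (X e ω ^ 2 / (2 * B ^ 2)) with hY
  have hYm : ∀ e, Measurable (Y e) := fun e => by fun_prop
  set F : Ω → ℝ := fun ω => ∏ e, Y e ω with hF
  have hFe : ∀ ω, F ω = Real.exp ((∑ e, X e ω ^ 2) / (2 * B ^ 2)) := fun ω => by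
    rw [hF, Finset.sum_div, Real.exp_sum]
  have hlint : ∫⁻ ω, ENNReal.ofReal (F ω) ∂μ ≤ ENNReal.ofReal (Real.exp (2 * (p * n ^ 2))) := by
    have h1 : ∀ ω, ENNReal.ofReal (F ω) = ∏ e, ENNReal.ofReal (Y e ω) := fun ω =>
      ENNReal.ofReal_prod_of_nonneg fun e _ => (Real.exp_pos _).le
    simp_rw [h1]
    rw [lintegral_prod_eq_prod_lintegral_of_indepFun Finset.univ (fun e ω => ENNReal.ofReal (Y e ω))
      (hXi.comp (fun _ x => ENNReal.ofReal (Real.exp (x ^ 2 / (2 * B ^ 2)))) fun _ => by fun_prop)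
      fun e => (hYm e).ennreal_ofReal]
    have h2 : ∀ e, ∫⁻ ω, ENNReal.ofReal (Y e ω) ∂μ ≤ ENNReal.ofReal (Real.exp (2 * p)) := by
      intro e
      obtain ⟨i1, i2⟩ := H.integral_exp_sq hB hp e
      rw [← ofReal_integral_eq_lintegral_ofReal i1
        (Filter.Eventually.of_forall fun _ => (Real.exp_pos _).le)]
      exact ENNReal.ofReal_le_ofReal i2
    refine (Finset.prod_le_prod' fun e _ => h2 e).trans ?_
    rw [Finset.prod_const, ← ENNReal.ofReal_pow (Real.exp_pos _).le, ← Real.exp_nat_mul]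
    refine ENNReal.ofReal_le_ofReal (Real.exp_le_exp.2 ?_)
    have hcard : ((Finset.univ : Finset (Sym2 (Fin n))).card : ℝ) ≤ n ^ 2 := by
      rw [Finset.card_univ, Sym2.card, Fintype.card_fin]
      have : (n + 1).choose 2 ≤ n ^ 2 := by
        rw [Nat.choose_two_right, Nat.add_sub_cancel]
        refine Nat.div_le_of_le_mul ?_
        nlinarith
      exact_mod_cast this
    nlinarith
  have hFm : Measurable F := by fun_prop
  have hsub : {ω | 6 * B ^ 2 * (p * n ^ 2) ≤ ∑ e, (η e ω * ξ e ω) ^ 2} ⊆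
      {ω | ENNReal.ofReal (Real.exp (3 * (p * n ^ 2))) ≤ ENNReal.ofReal (F ω)} := by
    intro ω hω
    rw [Set.mem_ofPred_eq] at hω ⊢
    refine ENNReal.ofReal_le_ofReal ?_
    rw [hFe, Real.exp_le_exp, le_div_iff₀ (by positivity)]
    calc 3 * (p * n ^ 2) * (2 * B ^ 2) = 6 * B ^ 2 * (p * n ^ 2) := by ring
      _ ≤ _ := hω
  have hmk := mul_meas_ge_le_lintegral hFm.ennreal_ofReal (μ := μ)
    (ENNReal.ofReal (Real.exp (3 * (p * n ^ 2))))
  refine (measure_mono hsub).trans ?_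
  have h3 := hmk.trans hlint
  rw [mul_comm, ← ENNReal.le_div_iff_mul_le (Or.inl (by simp [Real.exp_pos]))
    (Or.inl ENNReal.ofReal_ne_top), ← ENNReal.ofReal_div_of_pos (Real.exp_pos _),
    ← Real.exp_sub] at h3
  refine h3.trans (ENNReal.ofReal_le_ofReal (Real.exp_le_exp.2 (by linarith)))

lemma sum_sum_sym2_le {n : ℕ} (f : Sym2 (Fin n) → ℝ) (hf : ∀ e, 0 ≤ f e) :
    ∑ i, ∑ j, f s(i, j) ≤ 2 * ∑ e, f e := by
  classical
  have h1 : ∑ i, ∑ j, f s(i, j) =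
      ∑ e : Sym2 (Fin n), ∑ x : Fin n × Fin n with s(x.1, x.2) = e, f e := by
    rw [← Finset.sum_product', Finset.univ_product_univ,
      ← Finset.sum_fiberwise_of_maps_to (t := Finset.univ)
      (g := fun x : Fin n × Fin n => s(x.1, x.2)) fun _ _ => Finset.mem_univ _]
    refine Finset.sum_congr rfl fun e _ => Finset.sum_congr rfl fun x hx => ?_
    rw [(Finset.mem_filter.1 hx).2]
  rw [h1, Finset.mul_sum]
  refine Finset.sum_le_sum fun e _ => ?_
  rw [Finset.sum_const, nsmul_eq_mul]
  refine mul_le_mul_of_nonneg_right ?_ (hf e)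
  induction e with | _ a b =>
  have : (Finset.univ.filter fun x : Fin n × Fin n => s(x.1, x.2) = s(a, b)) ⊆
      {(a, b), (b, a)} := by
    intro x hx
    simp only [Finset.mem_insert, Finset.mem_singleton]
    rcases Sym2.eq_iff.1 (Finset.mem_filter.1 hx).2 with ⟨h1, h2⟩ | ⟨h1, h2⟩
    · exact Or.inl (Prod.ext h1 h2)
    · exact Or.inr (Prod.ext h1 h2)
  exact_mod_cast (Finset.card_le_card this).trans Finset.card_le_two

lemma sum_sq_sub_smul_one_le {n : ℕ} (A : Matrix (Fin n) (Fin n) ℝ) (lam : ℝ) :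
    ∑ i, ∑ j, (A - lam • (1 : Matrix (Fin n) (Fin n) ℝ)) i j ^ 2 ≤
      2 * ∑ i, ∑ j, A i j ^ 2 + 2 * (lam ^ 2 * n) := by
  have h1 : ∑ i : Fin n, ∑ j, (lam * (1 : Matrix (Fin n) (Fin n) ℝ) i j) ^ 2 = lam ^ 2 * n := by
    simp [Matrix.one_apply, mul_comm]
  rw [← h1, Finset.mul_sum, Finset.mul_sum, ← Finset.sum_add_distrib]
  refine Finset.sum_le_sum fun i _ => ?_
  rw [Finset.mul_sum, Finset.mul_sum, ← Finset.sum_add_distrib]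
  refine Finset.sum_le_sum fun j _ => ?_
  simp only [Matrix.sub_apply, Matrix.smul_apply, smul_eq_mul]
  nlinarith [sq_nonneg (A i j + lam * (1 : Matrix (Fin n) (Fin n) ℝ) i j)]

/-! ### The union bound -/

lemma sum_sq_le_of_sum_sq_sub_le {n : ℕ} (a c : Fin n → ℝ) {t : ℝ}
    (ha : ∑ i, a i ^ 2 ≤ t ^ 2) (hc : ∑ i, (a i - c i) ^ 2 ≤ t ^ 2) :
    ∑ i, c i ^ 2 ≤ (2 * t) ^ 2 := by
  have h1 : ∀ i, c i ^ 2 ≤ 2 * a i ^ 2 + 2 * (a i - c i) ^ 2 := fun i => by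
    nlinarith [sq_nonneg (2 * a i - c i)]
  have h2 := Finset.sum_le_sum fun i (_ : i ∈ Finset.univ) => h1 i
  rw [Finset.sum_add_distrib, ← Finset.mul_sum, ← Finset.mul_sum] at h2
  linarith

/-- Off the event of large Hilbert-Schmidt norm, a bad `v` produces a net point whose image has norm
at most `2t`, one `t` for `v` and one for the rounding. The number `q` is any bound for the small
ball factor per row at radius `2t`. -/
lemma IsSparseEntries.measure_exists_levelSet_le {Ω : Type*} [MeasurableSpace Ω] {μ : Measure Ω}
    [IsProbabilityMeasure μ] {n : ℕ} {p B : ℝ} {η ξ : Sym2 (Fin n) → Ω → ℝ}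
    (H : IsSparseEntries μ n p B η ξ) (hB : 0 < B) (hp : 0 < p) (hp1 : p ≤ 1) (hn : 0 < n)
    {δ₀ M ρ α h Q D K lam t q : ℝ} {σ τ' : EuclideanSpace ℝ (Fin n) → Finset (Fin n)}
    (hc : IsChoice M ρ σ τ') (hδ₀ : 0 < δ₀ * p) (hδ₀1 : δ₀ * p ≤ 1) (hM : 1 ≤ M) (hα : 0 < α)
    (hh : 0 < h) (hhn : 1 ≤ h * n) (hD : 0 < D) (hQ : 1 / α * (64 * D ^ 2) ≤ Q)
    (herr : 1 / α * (8 * (1 / ⌊M⌋₊) * (Real.posLog (Real.sqrt (δ₀ * p) * (4 * D)) / (δ₀ * p))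
      + 128 * D ^ 2 / n ^ 4) ≤ h ^ 2 * n)
    (hlam : lam ^ 2 ≤ K ^ 2 * (p * n)) (ht : 0 < t)
    (hht : h ^ 2 * ((24 * B ^ 2 + 2 * K ^ 2) * (p * n ^ 2)) ≤ t ^ 2)
    (hρ : 0 < ρ) (hhρ : h ≤ ρ / (2 * Real.sqrt (2 * n))) (hhM : h ≤ 1 / Real.sqrt M)
    (hq : 1 / Real.sqrt (p * n * ⌈M * ρ ^ 2 / 2⌉₊ * (ρ / (2 * Real.sqrt (2 * n))) ^ 2 /
        (2 * (2 * t) ^ 2)) + (16 * (1 + 24 * B ^ 4)) ^ 2 * (2 / Real.sqrt M) ^ 2 * n / (2 * t) ^ 2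
        ≤ q) :
    μ {ω | ∃ v ∈ levelSet δ₀ p M ρ α σ τ' D,
        ‖WithLp.toLp 2 ((sparseMatrix η ξ ω - lam • (1 : Matrix (Fin n) (Fin n) ℝ)) *ᵥ
          WithLp.ofLp v)‖ ≤ t} ≤
      ENNReal.ofReal (Real.exp (-(p * n ^ 2)) + (net n M ρ α h Q).card *
        (Real.exp (n / 2) * q ^ (n - ⌈M * ρ ^ 2 / 2⌉₊))) := by
  classical
  have hnR : (0 : ℝ) < n := by exact_mod_cast hn
  have hM0 : 0 < M := by linarith
  set lo : ℝ := ρ / (2 * Real.sqrt (2 * n)) with hlo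
  have hlo0 : 0 < lo := by positivity
  set hi : ℝ := 2 / Real.sqrt M with hhi
  set m : ℕ := ⌈M * ρ ^ 2 / 2⌉₊ with hm
  have hm0 : 0 < m := Nat.ceil_pos.2 (by positivity)
  set A : Ω → Matrix (Fin n) (Fin n) ℝ := fun ω =>
    sparseMatrix η ξ ω - lam • (1 : Matrix (Fin n) (Fin n) ℝ) with hA
  -- Only net points spread on some set of size `m` enter the union bound. The point chosen for `v`
  -- qualifies with `J = σ(v)`: on `σ(v)` the coordinates of `v` lie between `2 lo` and `hi/2`, and
  -- the rounding moves each by at most `h`, which is at most `lo` and at most `hi/2`.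
  set G : Finset (Fin n → ℝ) := (net n M ρ α h Q).filter fun x =>
    ∃ J : Finset (Fin n), J.card = m ∧ (∀ j ∈ J, lo ≤ |x j|) ∧ ∀ j ∈ J, |x j| ≤ hi with hG
  set E₁ : Set Ω := {ω | 6 * B ^ 2 * (p * n ^ 2) ≤ ∑ e, (η e ω * ξ e ω) ^ 2} with hE₁
  have hq0 : 0 ≤ q := le_trans (by positivity) hq
  have hsub : {ω | ∃ v ∈ levelSet δ₀ p M ρ α σ τ' D,
      ‖WithLp.toLp 2 ((A ω) *ᵥ WithLp.ofLp v)‖ ≤ t} ⊆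
      E₁ ∪ ⋃ x ∈ G, {ω | ∑ i, ((A ω) *ᵥ x) i ^ 2 ≤ (2 * t) ^ 2} := by
    rintro ω ⟨v, hv, hvt⟩
    by_cases hω : ω ∈ E₁
    · exact Or.inl hω
    · right
      rw [hE₁, Set.mem_ofPred_eq, not_le] at hω
      obtain ⟨x, hx, hx1, hx2⟩ := exists_mem_net hc hn hδ₀ hδ₀1 hM hα hh hhn hD hQ herr (A ω) hv
      -- The constant is `24 = 2 · 2 · 6`: one factor `2` for removing `λ`, one for counting
      -- unordered pairs twice.
      have hHS : ∑ i, ∑ j, A ω i j ^ 2 ≤ (24 * B ^ 2 + 2 * K ^ 2) * (p * n ^ 2) := by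
        have h1 := sum_sq_sub_smul_one_le (sparseMatrix η ξ ω) lam
        have h2 := sum_sum_sym2_le (fun e => (η e ω * ξ e ω) ^ 2) fun e => sq_nonneg _
        have h3 : ∑ i, ∑ j, sparseMatrix η ξ ω i j ^ 2 =
          ∑ i, ∑ j, (η s(i, j) ω * ξ s(i, j) ω) ^ 2 := rfl
        have h4 : lam ^ 2 * n ≤ K ^ 2 * (p * n) * n := by gcongr
        rw [h3] at h1
        refine h1.trans ?_
        nlinarith
      have hmem : x ∈ G := by
        refine Finset.mem_filter.2 ⟨hx, σ v, hc.card_sigma v hv.1, fun j hj => ?_, fun j hj => ?_⟩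
        · have h1 := (Finset.mem_filter.1 (hc.subset_spread v hv.1 hj)).2.1
          have h2 : ρ / Real.sqrt (2 * n) = 2 * lo := by rw [hlo]; field_simp
          have h3 := abs_sub_abs_le_abs_sub (v j) (x j)
          linarith [hx1 j]
        · have h1 := (Finset.mem_filter.1 (hc.subset_spread v hv.1 hj)).2.2
          have h2 : hi = 1 / Real.sqrt M + 1 / Real.sqrt M := by rw [hhi]; ring
          have h3 := abs_sub_abs_le_abs_sub (x j) (v j)
          rw [abs_sub_comm] at h3
          linarith [hx1 j]
      refine Set.mem_biUnion hmem ?_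
      rw [Set.mem_ofPred_eq]
      refine sum_sq_le_of_sum_sq_sub_le (fun i => ((A ω) *ᵥ WithLp.ofLp v) i) _ ?_ ?_
      · have := pow_le_pow_left₀ (norm_nonneg _) hvt 2
        rwa [EuclideanSpace.real_norm_sq_eq] at this
      · have e : ∀ i, ((A ω) *ᵥ WithLp.ofLp v) i - ((A ω) *ᵥ x) i =
            ((A ω) *ᵥ fun j => v j - x j) i := by
          intro i
          rw [← Pi.sub_apply, ← Matrix.mulVec_sub]
          rfl
        simp_rw [e]
        exact hx2.trans ((mul_le_mul_of_nonneg_left hHS (sq_nonneg h)).trans hht)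
  have hball : ∀ x ∈ G, μ {ω | ∑ i, ((A ω) *ᵥ x) i ^ 2 ≤ (2 * t) ^ 2} ≤
      ENNReal.ofReal (Real.exp (n / 2) * q ^ (n - m)) := by
    intro x hx
    obtain ⟨J, hJ, hJ1, hJ2⟩ := (Finset.mem_filter.1 hx).2
    refine (H.measure_norm_le_le hB hp hp1 hn (Finset.card_pos.1 (hJ ▸ hm0)) hlo0
      (by linarith : 0 < 2 * t) hJ1 hJ2 lam).trans (ENNReal.ofReal_le_ofReal ?_)
    rw [Finset.card_compl, Fintype.card_fin, hJ]
    refine mul_le_mul_of_nonneg_left (pow_le_pow_left₀ (by positivity) hq _) (Real.exp_pos _).le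
  calc _ ≤ μ E₁ + μ (⋃ x ∈ G, {ω | ∑ i, ((A ω) *ᵥ x) i ^ 2 ≤ (2 * t) ^ 2}) :=
        (measure_mono hsub).trans (measure_union_le _ _)
    _ ≤ ENNReal.ofReal (Real.exp (-(p * n ^ 2))) +
        ∑ _x ∈ G, ENNReal.ofReal (Real.exp (n / 2) * q ^ (n - m)) :=
        add_le_add (H.measure_sum_sq_ge_le hB hp.le hn)
          ((measure_biUnion_finset_le _ _).trans (Finset.sum_le_sum hball))
    _ ≤ ENNReal.ofReal (Real.exp (-(p * n ^ 2))) +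
        ENNReal.ofReal ((net n M ρ α h Q).card * (Real.exp (n / 2) * q ^ (n - m))) := by
        gcongr
        rw [Finset.sum_const, nsmul_eq_mul, ENNReal.ofReal_mul (Nat.cast_nonneg _),
          ENNReal.ofReal_natCast]
        gcongr
        exact Finset.filter_subset _ _
    _ = _ := (ENNReal.ofReal_add (Real.exp_pos _).le (by positivity)).symm

/-! ### The parameters -/

lemma log_le_of_rpow_le {n u δ : ℝ} (hn : 0 < n) (hu : 0 < u) (hδ : 0 < δ)
    (h : n ^ δ ≤ u ^ 32) : Real.log n ≤ 32 / δ * u := by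
  have h1 := Real.log_le_log (Real.rpow_pos_of_pos hn δ) h
  rw [Real.log_rpow hn, Real.log_pow] at h1
  have h2 := Real.log_le_sub_one_of_pos hu
  push_cast at h1
  rw [div_mul_eq_mul_div, le_div_iff₀ hδ]
  nlinarith

lemma pow_le_exp_of_mul_log_le {a c : ℝ} (ha : 1 ≤ a) {k : ℕ} {x : ℝ} (hk : (k : ℝ) ≤ x)
    (h : x * Real.log a ≤ c) : a ^ k ≤ Real.exp c := by
  have h0 : 0 < a := by linarith
  rw [← Real.exp_log h0, ← Real.exp_nat_mul, Real.exp_le_exp]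
  exact (mul_le_mul_of_nonneg_right hk (Real.log_nonneg ha)).trans h

/-- Since `log n ≤ u²/3`, the polynomial bases raised to the powers `u²` and `n/u⁴` each contribute
at most `exp(n)`. With the `4n` from the lattice radius this gives the `6` in the exponent. -/
lemma card_net_le_exp {n : ℕ} {ρ h δ u κ W : ℝ} (hδ : 0 < δ) (hn : 4 ≤ n) (hu : 2 ≤ u)
    (hun : u ^ 32 ≤ n) (hnu : (n : ℝ) ^ δ ≤ u ^ 32) (huδ : 96 / δ ≤ u) (hW1 : 1 ≤ W)
    (hW : ∀ s : Finset ℤ, ∑ m ∈ s, Real.exp (-(m : ℝ) ^ 2) ≤ W) :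
    ((net n (n / u ^ 4) ρ (1 / u ^ 2) h (κ * n)).card : ℝ) ≤
      Real.exp ((Real.log 4 + κ + 2 * Real.log W + 6) * n) := by
  have hn4 : (4 : ℝ) ≤ n := by exact_mod_cast hn
  have hnR : (0 : ℝ) < n := by linarith
  have hu1 : 1 ≤ u := by linarith
  have hW0 : 0 < W := by linarith
  have hlog := log_le_of_rpow_le hnR (by linarith) hδ hnu
  have hlog' : Real.log n ≤ u ^ 2 / 3 := by
    refine hlog.trans ?_
    have : 32 / δ = 96 / δ / 3 := by ring
    rw [this]
    nlinarith
  have h1 : ((n : ℝ) ^ 2 + 1) ^ ⌊1 / (1 / u ^ 2)⌋₊ ≤ Real.exp n := by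
    refine pow_le_exp_of_mul_log_le (by nlinarith) (Nat.floor_le (by positivity)) ?_
    have h2 : Real.log ((n : ℝ) ^ 2 + 1) ≤ 3 * Real.log n := by
      rw [show (3 : ℝ) * Real.log n = Real.log ((n : ℝ) ^ 3) by rw [Real.log_pow]; norm_num]
      refine Real.log_le_log (by positivity) ?_
      nlinarith [sq_nonneg (n : ℝ)]
    rw [one_div_one_div]
    calc u ^ 2 * Real.log ((n : ℝ) ^ 2 + 1) ≤ u ^ 2 * (3 * (u ^ 2 / 3)) := by gcongr; linarith
      _ = u ^ 4 := by ring
      _ ≤ u ^ 32 := pow_le_pow_right₀ hu1 (by norm_num)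
      _ ≤ n := hun
  have h2 : (2 * (n : ℝ) + 3) ^ ⌊(n : ℝ) / u ^ 4⌋₊ ≤ Real.exp n := by
    refine pow_le_exp_of_mul_log_le (by linarith) (Nat.floor_le (by positivity)) ?_
    have h2 : Real.log (2 * (n : ℝ) + 3) ≤ 2 * Real.log n := by
      rw [show (2 : ℝ) * Real.log n = Real.log ((n : ℝ) ^ 2) by rw [Real.log_pow]; norm_num]
      refine Real.log_le_log (by positivity) ?_
      nlinarith
    rw [div_mul_eq_mul_div, div_le_iff₀ (by positivity)]
    have h3 : u ^ 2 ≤ u ^ 4 := pow_le_pow_right₀ hu1 (by norm_num)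
    have h4 : 0 ≤ u ^ 2 := sq_nonneg u
    gcongr
    linarith
  have hWe : W ^ n = Real.exp (Real.log W * n) := by
    rw [mul_comm, Real.exp_nat_mul, Real.exp_log hW0]
  have h4e : (4 : ℝ) ^ n = Real.exp (Real.log 4 * n) := by
    rw [mul_comm, Real.exp_nat_mul, Real.exp_log (by norm_num)]
  refine (card_net_le (by omega) (by positivity) hW1 hW).trans ?_
  calc (4 : ℝ) ^ n * (((n : ℝ) ^ 2 + 1) ^ ⌊1 / (1 / u ^ 2)⌋₊ * ((Real.exp (κ * n) * W ^ n) *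
        (Real.exp (4 * n) * W ^ n * (2 * n + 3) ^ ⌊(n : ℝ) / u ^ 4⌋₊)))
      ≤ (4 : ℝ) ^ n * (Real.exp n * ((Real.exp (κ * n) * W ^ n) *
        (Real.exp (4 * n) * W ^ n * Real.exp n))) := by gcongr
    _ = _ := by
        rw [hWe, h4e]
        simp only [← Real.exp_add]
        ring_nf

lemma posLog_mul_pow_le {a u : ℝ} (ha : 0 ≤ a) (hu : 1 ≤ u) :
    Real.posLog (a * u ^ 15) ≤ (a + 15) * u := by
  have hu0 : 0 < u := by linarith
  rcases ha.eq_or_lt with rfl | h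
  · simp; linarith
  · have h1 := Real.log_le_sub_one_of_pos h
    have h2 := Real.log_le_sub_one_of_pos hu0
    rw [Real.posLog_def]
    refine max_le (by positivity) ?_
    change Real.log (a * u ^ 15) ≤ _
    rw [Real.log_mul h.ne' (by positivity), Real.log_pow]
    push_cast
    nlinarith

lemma two_mul_exp_neg_le {x : ℝ} (hx : 4 ≤ x) :
    Real.exp (-x) + Real.exp (-x) ≤ Real.exp (-(1 / 2 * x)) := by
  have h1 : Real.exp (-x) = Real.exp (-(1 / 2 * x)) * Real.exp (-(1 / 2 * x)) := by
    rw [← Real.exp_add]; ring_nf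
  have h2 : Real.exp (-(1 / 2 * x)) ≤ 1 / 2 := by
    rw [Real.exp_neg, one_div]
    refine inv_anti₀ (by norm_num) ?_
    have := Real.add_one_le_exp (1 / 2 * x)
    linarith
  rw [h1]
  nlinarith [Real.exp_pos (-(1 / 2 * x))]

set_option maxHeartbeats 1000000 in
/-- The probability bound, in terms of `u = (np)^{1/32}`. -/
lemma IsSparseEntries.measure_exists_levelSet_le_exp {Ω : Type*} [MeasurableSpace Ω]
    {μ : Measure Ω} [IsProbabilityMeasure μ] {n : ℕ} {p B : ℝ} {η ξ : Sym2 (Fin n) → Ω → ℝ}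
    (H : IsSparseEntries μ n p B η ξ) (hB : 0 < B) (hp : 0 < p) (hp1 : p ≤ 1) (hn : 4 ≤ n)
    {δ δ₀ cbar ρ r D K lam t u A q W : ℝ}
    {σ τ' : EuclideanSpace ℝ (Fin n) → Finset (Fin n)}
    (hδ : 0 < δ) (hδ₀ : 0 < δ₀) (hδ₀1 : δ₀ < 1) (hcbar : 0 < cbar) (hu : u ^ 32 = n * p)
    (hc : IsChoice (n / u ^ 4) ρ σ τ') (hr : 0 < r) (hrρ : r ≤ ρ) (hρ1 : ρ < 1)
    (hnu : (n : ℝ) ^ δ ≤ u ^ 32) (hD : 0 < D) (hD2 : D ≤ 1 / cbar * Real.sqrt (1 / u ^ 2 * n))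
    (hlam : lam ^ 2 ≤ K ^ 2 * (p * n)) (ht : 0 < t) (ht2 : t ^ 2 = 4 * u ^ 17 / ρ ^ 2)
    (hW1 : 1 ≤ W) (hW : ∀ s : Finset ℤ, ∑ m ∈ s, Real.exp (-(m : ℝ) ^ 2) ≤ W)
    (hA : A = Real.log 4 + 64 / cbar ^ 2 + 2 * Real.log W + 6)
    (hq : q = Real.exp (-(2 * (A + 2))))
    (hu2 : 2 ≤ u) (huδ : 96 / δ ≤ u) (huC : 24 * B ^ 2 + 2 * K ^ 2 ≤ u)
    (huE : (24 * B ^ 2 + 2 * K ^ 2) * (16 * (4 / cbar + 15) / δ₀ + 128 / cbar ^ 2) ≤ u)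
    (hur : 32 / (r ^ 4 * (24 * B ^ 2 + 2 * K ^ 2)) ≤ u) (huq : 2048 / (q ^ 2 * r ^ 6) ≤ u)
    (huB : (16 * (1 + 24 * B ^ 4)) ^ 2 / q ≤ u) :
    μ {ω | ∃ v ∈ levelSet δ₀ p (n / u ^ 4) ρ (1 / u ^ 2) σ τ' D,
        ‖WithLp.toLp 2 ((sparseMatrix η ξ ω - lam • (1 : Matrix (Fin n) (Fin n) ℝ)) *ᵥ
          WithLp.ofLp v)‖ ≤ t} ≤ ENNReal.ofReal (Real.exp (-(1 / 2 * n))) := by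
  have hn4 : (4 : ℝ) ≤ n := by exact_mod_cast hn
  have hnR : (0 : ℝ) < n := by linarith
  have hu0 : 0 < u := by linarith
  have hu1 : 1 ≤ u := by linarith
  have hun : u ^ 32 ≤ n := by rw [hu]; nlinarith
  have hupow : ∀ {a b : ℕ}, a ≤ b → u ^ a ≤ u ^ b := fun h => pow_le_pow_right₀ hu1 h
  have hρ0 : 0 < ρ := hr.trans_le hrρ
  have hρ2 : ρ ^ 2 ≤ 1 := pow_le_one₀ hρ0.le hρ1.le
  set C : ℝ := 24 * B ^ 2 + 2 * K ^ 2 with hC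
  have hC0 : 0 < C := by positivity
  have hpu : p = u ^ 32 / n := by rw [hu]; field_simp
  set M : ℝ := n / u ^ 4 with hM
  have hM2 : 2 ≤ M := by
    rw [hM, le_div_iff₀ (by positivity)]
    calc 2 * u ^ 4 ≤ u * u ^ 4 := by gcongr
      _ = u ^ 5 := by ring
      _ ≤ u ^ 32 := hupow (by norm_num)
      _ ≤ n := hun
  have hM0 : 0 < M := by linarith
  have hfl : M / 2 ≤ ⌊M⌋₊ := by
    have := Nat.lt_floor_add_one M
    linarith
  -- The mesh for which `h² C p n² = t²` exactly.
  set h : ℝ := Real.sqrt (4 / (ρ ^ 2 * C * u ^ 15 * n)) with hh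
  have hh0 : 0 < h := Real.sqrt_pos.2 (by positivity)
  have hh2 : h ^ 2 = 4 / (ρ ^ 2 * C * u ^ 15 * n) := Real.sq_sqrt (by positivity)
  have hh2n : h ^ 2 * n = 4 / (ρ ^ 2 * C * u ^ 15) := by rw [hh2]; field_simp
  have hD2' : D ^ 2 ≤ n / (u ^ 2 * cbar ^ 2) := by
    have h1 := pow_le_pow_left₀ hD.le hD2 2
    rw [mul_pow, Real.sq_sqrt (by positivity)] at h1
    refine h1.trans (le_of_eq ?_)
    field_simp
  have hhρ2 : h ^ 2 * n ≤ ρ ^ 2 / 8 := by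
    rw [hh2n, div_le_div_iff₀ (by positivity) (by norm_num)]
    rw [div_le_iff₀ (by positivity)] at hur
    have h1 : r ^ 4 ≤ ρ ^ 4 := pow_le_pow_left₀ hr.le hrρ 4
    have h2 : u ≤ u ^ 15 := le_self_pow₀ hu1 (by norm_num)
    calc (4 : ℝ) * 8 = 32 := by norm_num
      _ ≤ u * (r ^ 4 * C) := hur
      _ ≤ u ^ 15 * (ρ ^ 4 * C) := by gcongr
      _ = ρ ^ 2 * (ρ ^ 2 * C * u ^ 15) := by ring
  have hhn : 1 ≤ h * n := by
    have h1 : 1 ≤ (h * n) ^ 2 := by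
      rw [mul_pow, sq (n : ℝ), ← mul_assoc, hh2n, div_mul_eq_mul_div, one_le_div (by positivity)]
      calc ρ ^ 2 * C * u ^ 15 ≤ 1 * u * u ^ 15 := by gcongr
        _ = u ^ 16 := by ring
        _ ≤ u ^ 32 := hupow (by norm_num)
        _ ≤ 4 * n := by linarith
    exact (one_le_sq_iff₀ (by positivity)).1 h1
  have hδp : 0 < δ₀ * p := mul_pos hδ₀ hp
  have hδp1 : δ₀ * p ≤ 1 := mul_le_one₀ hδ₀1.le hp.le hp1
  have hlogarg : Real.sqrt (δ₀ * p) * (4 * D) ≤ 4 / cbar * u ^ 15 := by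
    refine le_of_sq_le_sq ?_ (by positivity)
    rw [mul_pow, Real.sq_sqrt hδp.le, mul_pow 4 D]
    calc δ₀ * p * (4 ^ 2 * D ^ 2) ≤ 1 * p * (4 ^ 2 * (n / (u ^ 2 * cbar ^ 2))) := by gcongr
      _ = (4 / cbar * u ^ 15) ^ 2 := by rw [hpu]; field_simp
  have hPL : Real.posLog (Real.sqrt (δ₀ * p) * (4 * D)) ≤ (4 / cbar + 15) * u :=
    (Real.posLog_le_posLog (by positivity) hlogarg).trans
      (posLog_mul_pow_le (by positivity) hu1)
  have hQ : 1 / (1 / u ^ 2) * (64 * D ^ 2) ≤ 64 / cbar ^ 2 * n := by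
    rw [one_div_one_div]
    calc u ^ 2 * (64 * D ^ 2) ≤ u ^ 2 * (64 * (n / (u ^ 2 * cbar ^ 2))) := by gcongr
      _ = _ := by field_simp
  -- The left side is of order `u⁻²⁵`: `u²` blocks, `1/M = u⁴/n`, a logarithm of order `u`, and `1/p
  -- = n/u³²`. The right side is of order `u⁻¹⁵`.
  have herr : 1 / (1 / u ^ 2) * (8 * (1 / ⌊M⌋₊) *
      (Real.posLog (Real.sqrt (δ₀ * p) * (4 * D)) / (δ₀ * p)) + 128 * D ^ 2 / n ^ 4) ≤
      h ^ 2 * n := by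
    have h1 : 1 / (⌊M⌋₊ : ℝ) ≤ 2 * u ^ 4 / n := by
      calc 1 / (⌊M⌋₊ : ℝ) ≤ 1 / (M / 2) := one_div_le_one_div_of_le (by positivity) hfl
        _ = _ := by rw [hM]; field_simp
    have h2 : 128 * D ^ 2 / (n : ℝ) ^ 4 ≤ 128 / cbar ^ 2 / u ^ 27 := by
      rw [div_le_div_iff₀ (by positivity) (by positivity)]
      have h3 : u ^ 27 ≤ n := (hupow (by norm_num)).trans hun
      have h4 : (n : ℝ) / (u ^ 2 * cbar ^ 2) ≤ n / (1 * cbar ^ 2) := by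
        gcongr
        exact one_le_pow₀ hu1
      calc 128 * D ^ 2 * u ^ 27 ≤ 128 * (n / (1 * cbar ^ 2)) * n := by
            gcongr
            exact hD2'.trans h4
        _ = 128 / cbar ^ 2 * (n ^ 2 * 1) := by field_simp
        _ ≤ 128 / cbar ^ 2 * (n ^ 2 * n ^ 2) := by
            gcongr
            nlinarith
        _ = _ := by ring
    rw [one_div_one_div, hh2n]
    calc _ ≤ u ^ 2 * (8 * (2 * u ^ 4 / n) * ((4 / cbar + 15) * u / (δ₀ * p)) +
          128 / cbar ^ 2 / u ^ 27) := by
          gcongr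
          exact div_nonneg Real.posLog_nonneg hδp.le
      _ = (16 * (4 / cbar + 15) / δ₀ + 128 / cbar ^ 2) / u ^ 25 := by
          rw [hpu]; field_simp; ring
      _ ≤ 4 / (ρ ^ 2 * C * u ^ 15) := by
          rw [div_le_div_iff₀ (by positivity) (by positivity)]
          calc _ = C * (16 * (4 / cbar + 15) / δ₀ + 128 / cbar ^ 2) * (ρ ^ 2 * u ^ 15) := by ring
            _ ≤ u * (1 * u ^ 15) := by gcongr
            _ = u ^ 16 := by ring
            _ ≤ u ^ 25 := hupow (by norm_num)
            _ ≤ 4 * u ^ 25 := by linarith [pow_pos hu0 25]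
  have hht : h ^ 2 * (C * (p * n ^ 2)) ≤ t ^ 2 := by
    rw [hh2, ht2, hpu]
    refine le_of_eq ?_
    field_simp
  have hsq2 : Real.sqrt (2 * n) ^ 2 = 2 * n := Real.sq_sqrt (by positivity)
  have hlo2 : (ρ / (2 * Real.sqrt (2 * n))) ^ 2 = ρ ^ 2 / (8 * n) := by
    rw [div_pow, mul_pow, hsq2]; ring
  have hhρ : h ≤ ρ / (2 * Real.sqrt (2 * n)) := by
    refine le_of_sq_le_sq ?_ (by positivity)
    rw [hlo2, le_div_iff₀ (by positivity)]
    linarith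
  have hhM : h ≤ 1 / Real.sqrt M := by
    refine le_of_sq_le_sq ?_ (by positivity)
    rw [div_pow, Real.sq_sqrt hM0.le, le_div_iff₀ hM0]
    calc h ^ 2 * M ≤ h ^ 2 * n := by
          gcongr
          exact div_le_self hnR.le (one_le_pow₀ hu1)
      _ ≤ 1 ^ 2 := by linarith
  have hq0 : 0 < q := hq ▸ Real.exp_pos _
  set m : ℕ := ⌈M * ρ ^ 2 / 2⌉₊ with hm
  -- The argument of the root is at least `u¹¹ρ⁶/512`, and the second term is of order `u⁻¹³`. Each
  -- is brought below `q/2` by taking `u` large.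
  have hqle : 1 / Real.sqrt (p * n * m * (ρ / (2 * Real.sqrt (2 * n))) ^ 2 /
        (2 * (2 * t) ^ 2)) + (16 * (1 + 24 * B ^ 4)) ^ 2 * (2 / Real.sqrt M) ^ 2 * n / (2 * t) ^ 2
        ≤ q := by
    have h1 : 4 / q ^ 2 ≤ p * n * m * (ρ / (2 * Real.sqrt (2 * n))) ^ 2 / (2 * (2 * t) ^ 2) := by
      rw [hlo2, mul_pow, ht2]
      rw [div_le_iff₀ (by positivity)] at huq
      calc 4 / q ^ 2 ≤ u * r ^ 6 / 512 := by
            rw [div_le_div_iff₀ (by positivity) (by norm_num)]; linarith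
        _ ≤ u ^ 11 * ρ ^ 6 / 512 := by
            gcongr
            exact le_self_pow₀ hu1 (by norm_num)
        _ = p * n * (M * ρ ^ 2 / 2) * (ρ ^ 2 / (8 * n)) / (2 * (2 ^ 2 * (4 * u ^ 17 / ρ ^ 2))) := by
            rw [hpu, hM]; field_simp; norm_num
        _ ≤ _ := by
            gcongr
            exact Nat.le_ceil _
    have h2 : 1 / Real.sqrt (p * n * m * (ρ / (2 * Real.sqrt (2 * n))) ^ 2 /
        (2 * (2 * t) ^ 2)) ≤ q / 2 := by
      have h3 : 2 / q ≤ Real.sqrt (p * n * m * (ρ / (2 * Real.sqrt (2 * n))) ^ 2 /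
          (2 * (2 * t) ^ 2)) := by
        refine Real.le_sqrt_of_sq_le (le_trans (le_of_eq ?_) h1)
        rw [div_pow]; norm_num
      calc _ ≤ 1 / (2 / q) := one_div_le_one_div_of_le (by positivity) h3
        _ = q / 2 := one_div_div _ _
    have h4 : (16 * (1 + 24 * B ^ 4)) ^ 2 * (2 / Real.sqrt M) ^ 2 * n / (2 * t) ^ 2 ≤ q / 2 := by
      rw [div_pow 2, Real.sq_sqrt hM0.le, mul_pow 2 t, ht2]
      rw [div_le_iff₀ hq0] at huB
      calc (16 * (1 + 24 * B ^ 4)) ^ 2 * (2 ^ 2 / M) * n / (2 ^ 2 * (4 * u ^ 17 / ρ ^ 2))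
          = (16 * (1 + 24 * B ^ 4)) ^ 2 * ρ ^ 2 / (4 * u ^ 13) := by
            rw [hM]; field_simp
        _ ≤ (u * q) * 1 / (4 * u ^ 13) := by gcongr
        _ = q / (4 * u ^ 12) := by field_simp
        _ ≤ q / (2 * 1) := by
            gcongr
            · norm_num
            · exact one_le_pow₀ hu1
        _ = q / 2 := by ring
    linarith
  have hmain := H.measure_exists_levelSet_le hB hp hp1 (by omega) hc hδp hδp1 (by linarith)
    (by positivity : 0 < 1 / u ^ 2) hh0 hhn hD hQ herr hlam ht hht hρ0 hhρ hhM hqle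
  refine hmain.trans (ENNReal.ofReal_le_ofReal ?_)
  have hcard := card_net_le_exp (ρ := ρ) (h := h) (κ := 64 / cbar ^ 2) hδ hn hu2 hun hnu huδ hW1 hW
  rw [← hA, ← hM] at hcard
  have hA0 : 0 ≤ A := by
    rw [hA]
    have := Real.log_nonneg hW1
    have := Real.log_nonneg (by norm_num : (1 : ℝ) ≤ 4)
    positivity
  have hm2 : (m : ℝ) ≤ n / 2 := by
    have h1 := (Nat.ceil_lt_add_one (by positivity : 0 ≤ M * ρ ^ 2 / 2)).le
    have h2 : M ≤ n / 2 := by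
      rw [hM]
      gcongr
      exact hu2.trans (le_self_pow₀ hu1 (by norm_num))
    have h3 : M * ρ ^ 2 ≤ M * 1 := by gcongr
    rw [← hm] at h1
    linarith
  have hnm : m ≤ n := by
    have : (m : ℝ) ≤ n := by linarith
    exact_mod_cast this
  -- At least half of the rows remain, so `q = exp(-2(A+2))` beats both the net size `exp(An)` and
  -- the factor `exp(n/2)`.
  have hqpow : q ^ (n - m) ≤ Real.exp (-(A + 2) * n) := by
    rw [hq, ← Real.exp_nat_mul, Real.exp_le_exp, Nat.cast_sub hnm]
    have : 0 ≤ (A + 2) * (n / 2 - m) := mul_nonneg (by linarith) (by linarith)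
    linarith
  have hpn : (n : ℝ) ≤ p * n ^ 2 := by
    have h1 : 1 ≤ n * p := hu ▸ one_le_pow₀ hu1
    calc (n : ℝ) = n * 1 := (mul_one _).symm
      _ ≤ n * (n * p) := by gcongr
      _ = p * n ^ 2 := by ring
  calc _ ≤ Real.exp (-(n : ℝ)) + Real.exp (A * n) * (Real.exp (n / 2) *
        Real.exp (-(A + 2) * n)) := by
        gcongr
    _ ≤ Real.exp (-(n : ℝ)) + Real.exp (-(n : ℝ)) := by
        rw [← Real.exp_add, ← Real.exp_add]
        gcongr
        linarith
    _ ≤ Real.exp (-(1 / 2 * n)) := two_mul_exp_neg_le hn4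

lemma rpow_eq_pow_of_pow_eq {N u : ℝ} (hu : 0 ≤ u) (h : u ^ 32 = N) (k : ℕ) {a : ℝ}
    (ha : a = k / 32) : N ^ a = u ^ k := by
  rw [← h, ← Real.rpow_natCast, ← Real.rpow_mul hu, ha, ← Real.rpow_natCast]
  congr 1
  push_cast
  ring

lemma parM_eq {n : ℕ} {p u : ℝ} (hu : 0 ≤ u) (h : u ^ 32 = n * p) : parM n p = n / u ^ 4 := by
  rw [parM, rpow_eq_pow_of_pow_eq hu h 4 (by norm_num)]

lemma parα_eq {n : ℕ} {p u : ℝ} (hu : 0 ≤ u) (h : u ^ 32 = n * p) : parα n p = 1 / u ^ 2 := by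
  rw [parα, Real.rpow_neg (h ▸ by positivity), rpow_eq_pow_of_pow_eq hu h 2 (by norm_num), one_div]

lemma parρ'_eq {C K : ℝ} {n : ℕ} {p u : ℝ} (hn : 0 < n) (hu : 0 < u) (h : u ^ 32 = n * p) :
    parρ' C K n p = parρ C K n p ^ 2 / 4 * (1 / u ^ 3) := by
  have hnR : (0 : ℝ) < n := by exact_mod_cast hn
  rw [parρ', parM_eq hu.le h, parα_eq hu.le h]
  congr 1
  rw [show (n / u ^ 4 * (1 / u ^ 2) / n : ℝ) = (1 / u ^ 3) ^ 2 by field_simp]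
  exact Real.sqrt_sq (by positivity)

lemma parε₀'_mul_sq {C K : ℝ} {n : ℕ} {p u : ℝ} (hn : 0 < n) (hu : 0 < u) (h : u ^ 32 = n * p)
    (hρ : 0 < parρ C K n p) :
    0 < parε₀' C K n p * (p * n) ^ (7 / 16 : ℝ) ∧
      (parε₀' C K n p * (p * n) ^ (7 / 16 : ℝ)) ^ 2 = 4 * u ^ 17 / parρ C K n p ^ 2 := by
  have hnR : (0 : ℝ) < n := by exact_mod_cast hn
  have e : parρ' C K n p * Real.sqrt (p * parM n p) = parρ C K n p ^ 2 / 4 * u ^ 11 := by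
    rw [parρ'_eq hn hu h, parM_eq hu.le h, show p * (n / u ^ 4) = (u ^ 14) ^ 2 by
      rw [← mul_div_assoc, mul_comm p, ← h]; field_simp, Real.sqrt_sq (by positivity)]
    field_simp
  have hpos : 0 < parρ C K n p ^ 2 / 4 * u ^ 11 := by positivity
  rw [parε₀', e, mul_comm p, rpow_eq_pow_of_pow_eq hu.le h 14 (by norm_num), rpow_neg_half hpos.le]
  refine ⟨by positivity, ?_⟩
  rw [mul_pow, inv_pow, Real.sq_sqrt hpos.le]
  field_simp

/-- The numerator is at least `-log 8 = -3 log 2` and the denominator is at least `16 log 2`, so the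
quotient exceeds `-1`. -/
lemma neg_one_le_ell₀ {n : ℕ} {p u : ℝ} (hp : 0 < p) (hp1 : p ≤ 1) (hu : 2 ≤ u)
    (h : u ^ 32 = n * p) : -1 ≤ ell₀ n p := by
  have hlog : Real.log (Real.sqrt (p * n)) = 16 * Real.log u := by
    rw [mul_comm p, ← h, show u ^ 32 = (u ^ 16) ^ 2 by ring, Real.sqrt_sq (by positivity),
      Real.log_pow]
    norm_num
  have hlu : Real.log 2 ≤ Real.log u := Real.log_le_log (by norm_num) hu
  have hl2 : 0 < Real.log 2 := Real.log_pos (by norm_num)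
  refine Int.le_ceil_iff.2 ?_
  rw [hlog]
  push_cast
  refine lt_of_lt_of_le (by norm_num : (-1 - 1 : ℝ) < -1) ?_
  rw [le_div_iff₀ (by linarith), one_div, Real.log_inv, Real.log_mul (by norm_num) hp.ne',
    show (8 : ℝ) = 2 ^ 3 by norm_num, Real.log_pow]
  have := Real.log_nonpos hp.le hp1
  push_cast
  linarith

/-- The denominator is at least `(δ/2) log n`, because `np ≥ n^δ`; the numerator is at most `log n`,
because `np ≥ 1`. -/
lemma ell₀_le {n : ℕ} {p u δ : ℝ} (hδ : 0 < δ) (hn : 4 ≤ n) (hp : 0 < p) (hu : 2 ≤ u)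
    (h : u ^ 32 = n * p) (hnu : (n : ℝ) ^ δ ≤ u ^ 32) : ell₀ n p ≤ ⌈2 / δ⌉ := by
  have hn4 : (4 : ℝ) ≤ n := by exact_mod_cast hn
  have hlog : Real.log (Real.sqrt (p * n)) = 16 * Real.log u := by
    rw [mul_comm p, ← h, show u ^ 32 = (u ^ 16) ^ 2 by ring, Real.sqrt_sq (by positivity),
      Real.log_pow]
    norm_num
  have hlu : 0 < Real.log u := Real.log_pos (by linarith)
  refine Int.ceil_le_ceil ?_
  rw [hlog, div_le_div_iff₀ (by linarith) hδ]
  have h1 : Real.log (n * p) = 32 * Real.log u := by rw [← h, Real.log_pow]; norm_num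
  rw [Real.log_mul (by linarith) hp.ne'] at h1
  have h2 := Real.log_le_log (by positivity) hnu
  rw [Real.log_rpow (by linarith), Real.log_pow] at h2
  have h3 : Real.log (1 / (8 * p)) ≤ Real.log n := by
    rw [one_div, Real.log_inv, Real.log_mul (by norm_num) hp.ne']
    have := Real.log_nonneg (by norm_num : (1 : ℝ) ≤ 8)
    linarith
  push_cast at h2
  nlinarith

/-- A lower bound for `ρ` depending only on `C`, `K`, `δ`. -/
lemma le_parρ {C K : ℝ} (hCK : 0 < C * K) {n : ℕ} {p : ℝ} {L : ℤ} (hL : ell₀ n p ≤ L)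
    (hL0 : -1 ≤ ell₀ n p) : (max (C * K) 1) ^ (-L - 6) ≤ parρ C K n p := by
  rw [parρ]
  rcases le_total (C * K) 1 with h | h
  · rw [max_eq_right h, one_zpow]
    exact one_le_zpow_of_nonpos₀ hCK h (by omega)
  · rw [max_eq_left h]
    exact zpow_le_zpow_right₀ h (by omega)

/-- The zero vector is sparse and at distance `1` from every unit vector. This disposes of values of
`CK` for which `ρ ≥ 1`. -/
lemma incomp_eq_empty {n : ℕ} {M ρ : ℝ} (hM : 0 ≤ M) (hρ : 1 ≤ ρ) : Incomp n M ρ = ∅ := by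
  refine Set.eq_empty_of_forall_notMem fun x hx => hx.2 ⟨hx.1, 0, ?_, ?_⟩
  · simpa [Sparse] using hM
  · rw [sub_zero, hx.1]; exact hρ

end SparseSym

end

/-! ### Choice of the constants and conclusion -/

theorem mainTheorem5 (δ B K C δ₀ cbar : ℝ) (hδ : 0 < δ) (hB : 0 < B) (hK : 0 < K) (hC : 0 < C)
    (hδ₀ : δ₀ ∈ Set.Ioo (0 : ℝ) 1) (hcbar : 0 < cbar) :
    ∃ c'' : ℝ, 0 < c'' ∧ ∃ ctilde : ℝ, 0 < ctilde ∧ ∃ n₀ : ℕ,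
      ∀ n : ℕ, n₀ ≤ n → ∀ p : ℝ, (n : ℝ) ^ (-1 + δ) ≤ p → p ≤ 1 →
      ∀ (Ω : Type*) [MeasurableSpace Ω] (μ : Measure Ω) [IsProbabilityMeasure μ]
        (η ξ : Sym2 (Fin n) → Ω → ℝ), SparseSym.IsSparseEntries μ n p B η ξ →
      ∀ σ τ' : EuclideanSpace ℝ (Fin n) → Finset (Fin n),
        SparseSym.IsChoice (SparseSym.parM n p) (SparseSym.parρ C K n p) σ τ' →
      ∀ lam ∈ Set.Icc (-(K * Real.sqrt (p * n))) (K * Real.sqrt (p * n)),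
      ∀ D : ℝ, SparseSym.parρ' C K n p * Real.sqrt (SparseSym.parM n p) ≤ D →
        D ≤ 1 / cbar * Real.sqrt (SparseSym.parα n p * n) →
        μ {ω | ∃ v ∈ SparseSym.levelSet δ₀ p (SparseSym.parM n p) (SparseSym.parρ C K n p)
              (SparseSym.parα n p) σ τ' D,
            ‖WithLp.toLp 2 ((SparseSym.sparseMatrix η ξ ω -
                lam • (1 : Matrix (Fin n) (Fin n) ℝ)) *ᵥ WithLp.ofLp v)‖ ≤
              ctilde * SparseSym.parε₀' C K n p * (p * n) ^ (7 / 16 : ℝ)} ≤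
          ENNReal.ofReal (Real.exp (-(c'' * n))) := by
  obtain ⟨W, hW1, hW⟩ := SparseSym.exists_sum_exp_neg_sq_le
  set r : ℝ := (max (C * K) 1) ^ (-⌈2 / δ⌉ - 6) with hr
  have hr0 : 0 < r := zpow_pos (by positivity) _
  set A : ℝ := Real.log 4 + 64 / cbar ^ 2 + 2 * Real.log W + 6 with hA
  set q : ℝ := Real.exp (-(2 * (A + 2))) with hq
  -- All largeness conditions bound `u` below by constants depending only on the six parameters,
  -- through `r`, `A`, `q` and `W`. Since `u ≥ n^{δ/32}`, a single `n₀` serves every admissible `p`.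
  have htend : Filter.Tendsto (fun n : ℕ => (n : ℝ) ^ (δ / 32)) Filter.atTop Filter.atTop :=
    (tendsto_rpow_atTop (by positivity)).comp tendsto_natCast_atTop_atTop
  have hev := fun x => htend.eventually_ge_atTop x
  obtain ⟨n₀, hn₀⟩ := Filter.eventually_atTop.1 ((Filter.eventually_ge_atTop 4).and
    ((hev 2).and ((hev (96 / δ)).and ((hev (24 * B ^ 2 + 2 * K ^ 2)).and
    ((hev ((24 * B ^ 2 + 2 * K ^ 2) * (16 * (4 / cbar + 15) / δ₀ + 128 / cbar ^ 2))).and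
    ((hev (32 / (r ^ 4 * (24 * B ^ 2 + 2 * K ^ 2)))).and
    ((hev (2048 / (q ^ 2 * r ^ 6))).and (hev ((16 * (1 + 24 * B ^ 4)) ^ 2 / q)))))))))
  refine ⟨1 / 2, by norm_num, 1, one_pos, n₀, ?_⟩
  intro n hn p hpn hp1 Ω _ μ _ η ξ H σ τ' hc lam hlam D hD1 hD2
  obtain ⟨hn4, h2, hδ', hC', hE, hr', hq', hB'⟩ := hn₀ n hn
  have hn0 : 0 < n := by omega
  have hnR : (0 : ℝ) < n := by exact_mod_cast hn0
  have hp : 0 < p := (Real.rpow_pos_of_pos hnR _).trans_le hpn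
  have hnp : (n : ℝ) ^ δ ≤ n * p := by
    calc (n : ℝ) ^ δ = n * (n : ℝ) ^ (-1 + δ) := by
          rw [Real.rpow_add hnR, Real.rpow_neg_one, mul_inv_cancel_left₀ hnR.ne']
      _ ≤ n * p := by gcongr
  set u : ℝ := ((n : ℝ) * p) ^ (1 / 32 : ℝ) with hu
  have hu32 : u ^ 32 = n * p := by
    rw [hu, ← Real.rpow_natCast, ← Real.rpow_mul (by positivity)]
    norm_num
  have hle : (n : ℝ) ^ (δ / 32) ≤ u := by
    rw [hu, show δ / 32 = δ * (1 / 32) by ring, Real.rpow_mul hnR.le]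
    exact Real.rpow_le_rpow (by positivity) hnp (by norm_num)
  have hu2 : 2 ≤ u := h2.trans hle
  have hu0 : 0 < u := by linarith
  have hnu : (n : ℝ) ^ δ ≤ u ^ 32 := hu32 ▸ hnp
  have hρ : r ≤ SparseSym.parρ C K n p :=
    SparseSym.le_parρ (mul_pos hC hK) (SparseSym.ell₀_le hδ hn4 hp hu2 hu32 hnu)
      (SparseSym.neg_one_le_ell₀ hp hp1 hu2 hu32)
  have hρ0 := hr0.trans_le hρ
  rcases lt_or_ge (SparseSym.parρ C K n p) 1 with hρ1 | hρ1
  · obtain ⟨ht, ht2⟩ := SparseSym.parε₀'_mul_sq hn0 hu0 hu32 hρ0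
    have hD : 0 < D := by
      refine lt_of_lt_of_le ?_ hD1
      rw [SparseSym.parρ'_eq hn0 hu0 hu32, SparseSym.parM_eq hu0.le hu32]
      positivity
    have hlam2 : lam ^ 2 ≤ K ^ 2 * (p * n) := by
      calc lam ^ 2 = |lam| ^ 2 := (sq_abs _).symm
        _ ≤ (K * Real.sqrt (p * n)) ^ 2 := pow_le_pow_left₀ (abs_nonneg _) (abs_le.2 hlam) 2
        _ = _ := by rw [mul_pow, Real.sq_sqrt (by positivity)]
    rw [SparseSym.parM_eq hu0.le hu32] at hc ⊢
    rw [SparseSym.parα_eq hu0.le hu32] at hD2 ⊢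
    rw [one_mul]
    exact H.measure_exists_levelSet_le_exp hB hp hp1 hn4 hδ hδ₀.1 hδ₀.2 hcbar hu32 hc hr0 hρ hρ1
      hnu hD hD2 hlam2 ht ht2 hW1 hW hA hq hu2 (hδ'.trans hle) (hC'.trans hle) (hE.trans hle)
      (hr'.trans hle) (hq'.trans hle) (hB'.trans hle)
  · have hM : 0 ≤ SparseSym.parM n p := by rw [SparseSym.parM_eq hu0.le hu32]; positivity
    have hempty : {ω | ∃ v ∈ SparseSym.levelSet δ₀ p (SparseSym.parM n p)
        (SparseSym.parρ C K n p) (SparseSym.parα n p) σ τ' D,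
        ‖WithLp.toLp 2 ((SparseSym.sparseMatrix η ξ ω -
          lam • (1 : Matrix (Fin n) (Fin n) ℝ)) *ᵥ WithLp.ofLp v)‖ ≤
            1 * SparseSym.parε₀' C K n p * (p * n) ^ (7 / 16 : ℝ)} = ∅ := by
      refine Set.eq_empty_of_forall_notMem ?_
      rintro ω ⟨v, hv, -⟩
      have := hv.1
      rw [SparseSym.incomp_eq_empty hM hρ1] at this
      exact this
    rw [hempty, measure_empty]
    exact zero_le
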